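/- Let $n\ge 0$, let $I\subseteq\mathbb R$ be open, let $Q,V\subseteq\mathbb R^n$ be open and star-shaped, and let $A\subseteq\mathbb R^n$ be open and connected (for instance $I=\mathbb R$, $Q=V=A=\mathbb R^n$, or an interval and small balls around the coordinates of a given point; empty sets are allowed). Let $f_1,\dots,f_n$ be real-valued $C^\infty$ functions $f_a(\ddot q,\dot q,q,t)$ on the set of all $(t,q,\dot q,\ddot q)\in I\times Q\times V\times A$. Indices run over $1,\dots,n$, repeated indices are summed, and $$\frac{dF}{dt}=\frac{\partial F}{\partial t}+\dot q^c\frac{\partial F}{\partial q^c}+\ddot q^c\frac{\partial F}{\partial\dot q^c}+\dddot q^{\,c}\frac{\partial F}{\partial\ddot q^c}$$ denotes the total time derivative of a function $F(\ddot q,\dot q,q,t)$; the third derivatives $\dddot q\in\mathbb R^n$ are unrestricted. Set $$r_{ab}=\frac{\partial f_a}{\partial q^b}-\frac{\partial f_b}{\partial q^a}+\frac12\frac{d}{dt}\left(\frac{\partial f_b}{\partial\dot q^a}-\frac{\partial f_a}{\partial\dot q^b}\right),\qquad s_{ab}=\frac12\left(\frac{\partial f_a}{\partial\dot q^b}+\frac{\partial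 f_b}{\partial\dot q^a}\right)-\frac{d}{dt}\left(\frac{\partial f_b}{\partial\ddot q^a}\right).$$ A function is of first order if it depends on $(t,q,\dot q)$ only. The equations $f_a=0$ are said to be of Lagrangian form with dissipative forces of gradient type if there are $C^\infty$ functions $\Lambda(\dot q,q,t)$ and $D(\dot q,q,t)$ on $I\times Q\times V$ such that, for all $a$, $$f_a=\frac{d}{dt}\left(\frac{\partial\Lambda}{\partial\dot q^a}\right)-\frac{\partial\Lambda}{\partial q^a}+\frac{\partial D}{\partial\dot q^a}\quad\text{on } I\times Q\times V\times A.$$ (1) The equations $f_a=0$ are of Lagrangian form with dissipative forces of gradient type if and only if the following conditions hold for all $a,b,c$: (i) the functions $r_{ab}$ and $s_{ab}$ are of first order; (ii) $\dfrac{\partial f_a}{\partial\ddot q^b}=\dfrac{\partial f_b}{\partial\ddot q^a}$; (iii) $\dfrac{\partial r_{ab}}{\partial\dot q^c}=\dfrac{\partial s_{ac}}{\partial q^b}-\dfrac{\partial s_{bc}}{\partial q^a}$. (2) Conditions (i)–(iii) imply, for all $a,b,c$, $$\frac{\partial s_{ab}}{\partial\dot q^c}=\frac{\partial s_{ac}}{\partial\dot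 q^b}\qquad\text{and}\qquad \frac{\partial r_{ab}}{\partial q^c}+\frac{\partial r_{bc}}{\partial q^a}+\frac{\partial r_{ca}}{\partial q^b}=0,$$ so these two conditions, which were imposed in addition in an earlier version of the criterion, are redundant. (3) Conditions (i)–(iii) hold if and only if there are $C^\infty$ functions $g_{ab}(\dot q,q,t)$ and $h_a(\dot q,q,t)$ on $I\times Q\times V$ with $g_{ab}=g_{ba}$ such that $f_a=g_{ab}\ddot q^b+h_a$ on $I\times Q\times V\times A$ and, for all $a,b,c$, $$\frac{\partial g_{ab}}{\partial\dot q^c}-\frac{\partial g_{ac}}{\partial\dot q^b}=0,\qquad \frac{\partial^2h_a}{\partial\dot q^b\partial\dot q^c}-\frac{\partial^2h_b}{\partial\dot q^a\partial\dot q^c}=2\left(\frac{\partial g_{ac}}{\partial q^b}-\frac{\partial g_{bc}}{\partial q^a}\right),$$ $$\sum_{a,b,c}\left(\frac{\partial^2h_a}{\partial q^b\partial\dot q^c}-\frac{\partial^2h_a}{\partial q^c\partial\dot q^b}\right)=0,$$ where $\sum_{a,b,c}$ denotes the cyclic sum over $a,b,c$. -/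

import Mathlib

open scoped ContDiff

/-- Jet coordinates of order `k` for `n` degrees of freedom: a point `p` consists of the time
`p.1` and, for each `i ≤ k`, of the coordinates `p.2 i a` of the `i`-th time derivative of `q^a`
(so `p.2 0` is the position, `p.2 1` the velocity, `p.2 2` the acceleration, ...). -/
abbrev Jet (k n : ℕ) : Type := ℝ × (Fin (k + 1) → Fin n → ℝ)

/-- Forget the coordinates of highest order. -/
def jetProj {k n : ℕ} (p : Jet (k + 1) n) : Jet k n := (p.1, fun i => p.2 i.castSucc)

/-- The partial derivative `∂F/∂t`. -/
noncomputable def pdT {k n : ℕ} (F : Jet k n → ℝ) (p : Jet k n) : ℝ :=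
  fderiv ℝ F p (1, 0)

/-- The partial derivative of `F` with respect to the `a`-th coordinate of order `i`:
`pd 0 a F = ∂F/∂q^a`, `pd 1 a F` is the derivative with respect to the velocity `q̇^a`, and
`pd 2 a F` the derivative with respect to the acceleration `q̈^a`. -/
noncomputable def pd {k n : ℕ} (i : Fin (k + 1)) (a : Fin n) (F : Jet k n → ℝ) (p : Jet k n) : ℝ :=
  fderiv ℝ F p (0, Pi.single i (Pi.single a 1))

/-- The total time derivative `dF/dt` of a function of order `k`, a function of order `k + 1`. -/
noncomputable def totalDeriv {k n : ℕ} (F : Jet k n → ℝ) (p : Jet (k + 1) n) : ℝ :=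
  pdT F (jetProj p) + ∑ i : Fin (k + 1), ∑ c : Fin n, p.2 i.succ c * pd i c F (jetProj p)

/-- First-order jets with time in `I`, position in `Q` and velocity in `V`. -/
def dom1 {n : ℕ} (I : Set ℝ) (Q V : Set (Fin n → ℝ)) : Set (Jet 1 n) :=
  {p | p.1 ∈ I ∧ p.2 0 ∈ Q ∧ p.2 1 ∈ V}

/-- Second-order jets with time in `I`, position in `Q`, velocity in `V`, acceleration in `A`. -/
def dom2 {n : ℕ} (I : Set ℝ) (Q V A : Set (Fin n → ℝ)) : Set (Jet 2 n) :=
  {p | p.1 ∈ I ∧ p.2 0 ∈ Q ∧ p.2 1 ∈ V ∧ p.2 2 ∈ A}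

/-- Third-order jets over `dom2`; the third derivatives are unrestricted. -/
def dom3 {n : ℕ} (I : Set ℝ) (Q V A : Set (Fin n → ℝ)) : Set (Jet 3 n) :=
  {p | jetProj p ∈ dom2 I Q V A}

/-- On `S`, the function `F` is of first order: it does not depend on the accelerations and on the
third derivatives. -/
def IsFirstOrderOn {n : ℕ} (S : Set (Jet 3 n)) (F : Jet 3 n → ℝ) : Prop :=
  ∀ p ∈ S, ∀ p' ∈ S, jetProj (jetProj p) = jetProj (jetProj p') → F p = F p'

/-- `r_ab = ∂f_a/∂q^b - ∂f_b/∂q^a + (1/2) d/dt (∂f_b/∂q̇^a - ∂f_a/∂q̇^b)`. -/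
noncomputable def rCoeff {n : ℕ} (f : Fin n → Jet 2 n → ℝ) (a b : Fin n) (p : Jet 3 n) : ℝ :=
  pd 0 b (f a) (jetProj p) - pd 0 a (f b) (jetProj p)
    + (1 / 2) * totalDeriv (fun x => pd 1 a (f b) x - pd 1 b (f a) x) p

/-- `s_ab = (1/2) (∂f_a/∂q̇^b + ∂f_b/∂q̇^a) - d/dt (∂f_b/∂q̈^a)`. -/
noncomputable def sCoeff {n : ℕ} (f : Fin n → Jet 2 n → ℝ) (a b : Fin n) (p : Jet 3 n) : ℝ :=
  (1 / 2) * (pd 1 b (f a) (jetProj p) + pd 1 a (f b) (jetProj p))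
    - totalDeriv (pd 2 a (f b)) p

/-- The equations `f_a = 0` are of Lagrangian form with dissipative forces of gradient type:
`f_a = d/dt (∂Λ/∂q̇^a) - ∂Λ/∂q^a + ∂D/∂q̇^a` for smooth first-order functions `Λ` and `D`. -/
def IsLagrangianDissipative {n : ℕ} (I : Set ℝ) (Q V A : Set (Fin n → ℝ))
    (f : Fin n → Jet 2 n → ℝ) : Prop :=
  ∃ Λ D : Jet 1 n → ℝ,
    ContDiffOn ℝ ∞ Λ (dom1 I Q V) ∧ ContDiffOn ℝ ∞ D (dom1 I Q V) ∧
    ∀ a, ∀ p ∈ dom2 I Q V A,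
      f a p = totalDeriv (pd 1 a Λ) p - pd 0 a Λ (jetProj p) + pd 1 a D (jetProj p)

/-- The reduced generalized Helmholtz conditions: `r_ab` and `s_ab` are of first order,
`∂f_a/∂q̈^b = ∂f_b/∂q̈^a`, and `∂r_ab/∂q̇^c = ∂s_ac/∂q^b - ∂s_bc/∂q^a`. -/
def ReducedHelmholtz {n : ℕ} (I : Set ℝ) (Q V A : Set (Fin n → ℝ))
    (f : Fin n → Jet 2 n → ℝ) : Prop :=
  (∀ a b, IsFirstOrderOn (dom3 I Q V A) (rCoeff f a b)) ∧
  (∀ a b, IsFirstOrderOn (dom3 I Q V A) (sCoeff f a b)) ∧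
  (∀ a b, ∀ p ∈ dom2 I Q V A, pd 2 b (f a) p = pd 2 a (f b) p) ∧
  (∀ a b c, ∀ p ∈ dom3 I Q V A,
    pd 1 c (rCoeff f a b) p = pd 0 b (sCoeff f a c) p - pd 0 a (sCoeff f b c) p)

/-- The formulation in terms of coefficients: `f_a = g_ab q̈^b + h_a` with smooth first-order `g_ab`
and `h_a`, where `g_ab = g_ba`, `∂g_ab/∂q̇^c = ∂g_ac/∂q̇^b`,
`∂²h_a/∂q̇^b∂q̇^c - ∂²h_b/∂q̇^a∂q̇^c = 2 (∂g_ac/∂q^b - ∂g_bc/∂q^a)`, and the cyclic sum over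
`a, b, c` of `∂²h_a/∂q^b∂q̇^c - ∂²h_a/∂q^c∂q̇^b` vanishes. -/
def CoefficientHelmholtz {n : ℕ} (I : Set ℝ) (Q V A : Set (Fin n → ℝ))
    (f : Fin n → Jet 2 n → ℝ) : Prop :=
  ∃ (g : Fin n → Fin n → Jet 1 n → ℝ) (h : Fin n → Jet 1 n → ℝ),
    (∀ a b, ContDiffOn ℝ ∞ (g a b) (dom1 I Q V)) ∧
    (∀ a, ContDiffOn ℝ ∞ (h a) (dom1 I Q V)) ∧
    (∀ a, ∀ p ∈ dom2 I Q V A,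
      f a p = ∑ b, g a b (jetProj p) * p.2 2 b + h a (jetProj p)) ∧
    (∀ a b, ∀ x ∈ dom1 I Q V, g a b x = g b a x) ∧
    (∀ a b c, ∀ x ∈ dom1 I Q V, pd 1 c (g a b) x - pd 1 b (g a c) x = 0) ∧
    (∀ a b c, ∀ x ∈ dom1 I Q V,
      pd 1 b (pd 1 c (h a)) x - pd 1 a (pd 1 c (h b)) x
        = 2 * (pd 0 b (g a c) x - pd 0 a (g b c) x)) ∧
    (∀ a b c, ∀ x ∈ dom1 I Q V,
      (pd 0 b (pd 1 c (h a)) x - pd 0 c (pd 1 b (h a)) x)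
        + (pd 0 c (pd 1 a (h b)) x - pd 0 a (pd 1 c (h b)) x)
        + (pd 0 a (pd 1 b (h c)) x - pd 0 b (pd 1 a (h c)) x) = 0)

/-! The third derivatives enter `s_ab` linearly, with coefficients `-∂²f_b/∂q̈^a∂q̈^c`. If `s_ab` is
of first order these vanish, and since `A` is connected, `f_a = g_ab q̈^b + h_a`
(`exists_isAffineOn`). For such `f` the functions `s_ab`, and `r_ab` once the conditions on `g` are
known, are affine in `q̈`. Setting the coefficients of `q̈` to zero and rewriting (iii) yields
exactly the conditions on `g` and `h` in (3) (`reducedHelmholtz_iff_of_isAffineOn`).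

What remains is algebra with commuting derivations `T`, `d a`, `e a` (for `∂/∂t`, `∂/∂q^a`,
`∂/∂q̇^a`) and `Dt = ∂/∂t + q̇^c ∂/∂q^c`, whose only nontrivial commutator is `[e a, Dt] = d a`.
Necessity and the redundant identities of (2) are computations of this kind.

For sufficiency (`Helmholtz.exists_isLagrangian`), the Poincaré lemma in the velocities, used twice,
makes `g` the velocity Hessian of some `K`. Let `k` be what is left of `h` after removing the
Euler–Lagrange expression of `K`. Its velocity curl does not depend on the velocities and is a
closed 2-form in the positions, so it is the curl of some `2α(q, t)`. Removing the Euler–Lagrange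
expression of `α_b q̇^b` leaves a velocity gradient `∂D/∂q̇^a`, and `Λ = K + α_b q̇^b`. The two
Poincaré lemmas (`exists_potential`, `exists_potential_of_closed`) contract only the velocities or
only the positions, so star-shapedness of `V` and `Q` suffices. -/

/-! ### Smooth dependence of integrals over [0, 1] on parameters. -/

open MeasureTheory Set Filter Topology in
theorem hasFDerivAt_intervalIntegral_of_contDiffOn {E G : Type} [NormedAddCommGroup E]
    [NormedSpace ℝ E] [LocallyCompactSpace E] [NormedAddCommGroup G] [NormedSpace ℝ G]
    {W : Set (E × ℝ)} (hW : IsOpen W) {F : E × ℝ → G}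
    (hF : ContDiffOn ℝ ∞ F W) {x₀ : E} (hx₀ : ∀ τ ∈ Icc (0 : ℝ) 1, (x₀, τ) ∈ W) :
    HasFDerivAt (fun x => ∫ τ in (0 : ℝ)..1, F (x, τ))
      (∫ τ in (0 : ℝ)..1, (fderiv ℝ F (x₀, τ)).comp (ContinuousLinearMap.inl ℝ E ℝ)) x₀ := by
  -- The tube lemma and local compactness give a compact neighbourhood `K` of `x₀` with `K × [0, 1]
  -- ⊆ W`; there the derivative is bounded by a constant, which serves as the dominating function.
  obtain ⟨u, v, hu, -, hxu, hv, huv⟩ := generalized_tube_lemma (isCompact_singleton (x := x₀))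
    (isCompact_Icc (a := (0 : ℝ)) (b := 1)) hW (by rintro ⟨x, τ⟩ ⟨rfl, h⟩; exact hx₀ τ h)
  obtain ⟨K, hK, hKu, hKc⟩ := local_compact_nhds (hu.mem_nhds (hxu rfl))
  have hKW : K ×ˢ Icc (0 : ℝ) 1 ⊆ W := (prod_mono hKu hv).trans huv
  have hF' : ContinuousOn (fun p : E × ℝ => (fderiv ℝ F p).comp
      (ContinuousLinearMap.inl ℝ E ℝ)) W :=
    ((hF.continuousOn_fderiv_of_isOpen hW (by simp))).clm_comp continuousOn_const
  obtain ⟨C, hC⟩ := (hKc.prod isCompact_Icc).exists_bound_of_continuousOn (hF'.mono hKW)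
  have hsec : ∀ x ∈ K, ContinuousOn (fun τ : ℝ => (x, τ)) (Icc 0 1) := fun x _ => by fun_prop
  have hmap : ∀ x ∈ K, MapsTo (fun τ : ℝ => (x, τ)) (Icc 0 1) W :=
    fun x hx τ hτ => hKW ⟨hx, hτ⟩
  have h01 : Set.uIoc (0 : ℝ) 1 ⊆ Icc (0 : ℝ) 1 := by
    rw [uIoc_of_le zero_le_one]; exact Ioc_subset_Icc_self
  have hx₀K : x₀ ∈ K := mem_of_mem_nhds hK
  refine intervalIntegral.hasFDerivAt_integral_of_dominated_of_fderiv_le (𝕜 := ℝ)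
    (F := fun x τ => F (x, τ))
    (F' := fun x τ => (fderiv ℝ F (x, τ)).comp (ContinuousLinearMap.inl ℝ E ℝ))
    (bound := fun _ => C) (s := K) hK ?_ ?_ ?_ ?_ ?_ ?_
  · filter_upwards [hK] with x hx
    refine ContinuousOn.aestronglyMeasurable ?_ measurableSet_uIoc
    exact (hF.continuousOn.comp (hsec x hx) (hmap x hx)).mono h01
  · refine ContinuousOn.intervalIntegrable ?_
    rw [uIcc_of_le zero_le_one]
    exact hF.continuousOn.comp (hsec x₀ hx₀K) (hmap x₀ hx₀K)
  · refine ContinuousOn.aestronglyMeasurable ?_ measurableSet_uIoc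
    exact (hF'.comp (hsec x₀ hx₀K) (hmap x₀ hx₀K)).mono h01
  · exact ae_of_all _ fun τ hτ x hx => hC (x, τ) ⟨hx, h01 hτ⟩
  · exact intervalIntegrable_const
  · refine ae_of_all _ fun τ hτ x hx => ?_
    have h1 : HasFDerivAt F (fderiv ℝ F (x, τ)) (x, τ) :=
      ((hF.contDiffAt (hW.mem_nhds (hKW ⟨hx, h01 hτ⟩))).differentiableAt (by simp)).hasFDerivAt
    exact h1.comp x (hasFDerivAt_prodMk_left x τ)

/-- Induction on the order: the derivative of the integral is again such an integral, with values in
`E →L[ℝ] G`. This is why `G` is quantified inside the induction. -/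
theorem contDiffOn_intervalIntegral {E : Type} [NormedAddCommGroup E]
    [NormedSpace ℝ E] [LocallyCompactSpace E]
    {W : Set (E × ℝ)} (hW : IsOpen W) {U : Set E} (hU : IsOpen U)
    (hUW : ∀ x ∈ U, ∀ τ ∈ Set.Icc (0 : ℝ) 1, (x, τ) ∈ W) (m : ℕ) :
    ∀ {G : Type} [NormedAddCommGroup G] [NormedSpace ℝ G] {F : E × ℝ → G},
      ContDiffOn ℝ ∞ F W → ContDiffOn ℝ m (fun x => ∫ τ in (0 : ℝ)..1, F (x, τ)) U := by
  induction m with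
  | zero =>
    intro G _ _ F hF
    exact contDiffOn_zero.2 fun x hx =>
      (hasFDerivAt_intervalIntegral_of_contDiffOn hW hF (hUW x hx)).continuousAt.continuousWithinAt
  | succ m ih =>
    intro G _ _ F hF
    rw [Nat.cast_succ, contDiffOn_succ_iff_fderiv_of_isOpen hU]
    refine ⟨fun x hx =>
      (hasFDerivAt_intervalIntegral_of_contDiffOn hW hF
        (hUW x hx)).differentiableAt.differentiableWithinAt, fun h => absurd h (by simp), ?_⟩
    have hF' : ContDiffOn ℝ ∞ (fun p : E × ℝ => (fderiv ℝ F p).comp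
        (ContinuousLinearMap.inl ℝ E ℝ)) W :=
      (hF.fderiv_of_isOpen hW (by simp)).clm_comp contDiffOn_const
    exact (ih hF').congr fun x hx =>
      (hasFDerivAt_intervalIntegral_of_contDiffOn hW hF (hUW x hx)).fderiv

/-! ### The algebra of smooth functions on an open set and its directional derivations. -/

/-- The algebra of smooth functions on the set `U`. -/
def Smooth {E : Type} [NormedAddCommGroup E] [NormedSpace ℝ E] (U : Set E) :
    Subalgebra ℝ (U → ℝ) where
  carrier := {F | ∃ G : E → ℝ, ContDiffOn ℝ ∞ G U ∧ ∀ x : U, F x = G x}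
  mul_mem' := by
    rintro F F' ⟨G, hG, h⟩ ⟨G', hG', h'⟩
    exact ⟨G * G', hG.mul hG', fun x => by simp [h, h']⟩
  add_mem' := by
    rintro F F' ⟨G, hG, h⟩ ⟨G', hG', h'⟩
    exact ⟨G + G', hG.add hG', fun x => by simp [h, h']⟩
  algebraMap_mem' r := ⟨fun _ => r, contDiffOn_const, fun _ => rfl⟩

namespace Smooth

variable {E : Type} [NormedAddCommGroup E] [NormedSpace ℝ E] {U : Set E}

/-- The element of `Smooth U` given by a function that is smooth on `U`. -/
def mk (G : E → ℝ) (hG : ContDiffOn ℝ ∞ G U) : Smooth U :=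
  ⟨fun x => G x, G, hG, fun _ => rfl⟩

/-- A function on the whole space that represents an element of `Smooth U`. -/
noncomputable def rep (F : Smooth U) : E → ℝ := F.2.choose

theorem contDiffOn_rep (F : Smooth U) : ContDiffOn ℝ ∞ (rep F) U := F.2.choose_spec.1

theorem rep_apply (F : Smooth U) {x : E} (hx : x ∈ U) : rep F x = F.1 ⟨x, hx⟩ :=
  (F.2.choose_spec.2 ⟨x, hx⟩).symm

theorem ext_rep {F F' : Smooth U} (h : ∀ x ∈ U, rep F x = rep F' x) : F = F' := by
  ext x
  rw [← rep_apply F x.2, ← rep_apply F' x.2, h x x.2]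

theorem rep_mk {G : E → ℝ} (hG : ContDiffOn ℝ ∞ G U) {x : E} (hx : x ∈ U) :
    (rep (mk G hG)) x = G x := rep_apply _ hx

theorem rep_add (F F' : Smooth U) {x : E} (hx : x ∈ U) :
    (rep (F + F')) x = rep F x + rep F' x := by
  simp [rep_apply _ hx]

theorem rep_sub (F F' : Smooth U) {x : E} (hx : x ∈ U) :
    (rep (F - F')) x = rep F x - rep F' x := by
  simp [rep_apply _ hx]

theorem rep_mul (F F' : Smooth U) {x : E} (hx : x ∈ U) :
    (rep (F * F')) x = rep F x * rep F' x := by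
  simp [rep_apply _ hx]

theorem rep_smul (r : ℝ) (F : Smooth U) {x : E} (hx : x ∈ U) :
    (rep (r • F)) x = r * rep F x := by
  simp [rep_apply _ hx]

theorem rep_zero {x : E} (hx : x ∈ U) : (rep (0 : Smooth U)) x = 0 := by
  simp [rep_apply _ hx]

theorem rep_one {x : E} (hx : x ∈ U) : (rep (1 : Smooth U)) x = 1 := by
  simp [rep_apply _ hx]

theorem rep_sum {ι : Type} (s : Finset ι) (F : ι → Smooth U) {x : E} (hx : x ∈ U) :
    (rep (∑ i ∈ s, F i)) x = ∑ i ∈ s, (rep (F i)) x := by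
  simp [rep_apply _ hx]

theorem contDiffAt_rep (hU : IsOpen U) (F : Smooth U) {x : E} (hx : x ∈ U) :
    ContDiffAt ℝ ∞ (rep F) x :=
  (contDiffOn_rep F).contDiffAt (hU.mem_nhds hx)

theorem differentiableAt_rep (hU : IsOpen U) (F : Smooth U) {x : E} (hx : x ∈ U) :
    DifferentiableAt ℝ (rep F) x :=
  (contDiffAt_rep hU F hx).differentiableAt (by simp)

theorem contDiffOn_fderiv_apply (hU : IsOpen U) {G : E → ℝ} (hG : ContDiffOn ℝ ∞ G U) (u : E) :
    ContDiffOn ℝ ∞ (fun x => fderiv ℝ G x u) U :=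
  (hG.fderiv_of_isOpen hU (by simp)).clm_apply contDiffOn_const

/-- Makes derivatives on `U` independent of the representative chosen by `rep`. -/
theorem fderiv_congr_of_isOpen (hU : IsOpen U) {G G' : E → ℝ} (h : ∀ x ∈ U, G x = G' x) {x : E}
    (hx : x ∈ U) : fderiv ℝ G x = fderiv ℝ G' x :=
  Filter.EventuallyEq.fderiv_eq (by filter_upwards [hU.mem_nhds hx] with y hy using h y hy)

/-- The derivative in the direction `u`, as a derivation of `Smooth U`. -/
noncomputable def dir (hU : IsOpen U) (u : E) : Derivation ℝ (Smooth U) (Smooth U) :=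
  Derivation.mk'
    { toFun := fun F => mk _ (contDiffOn_fderiv_apply hU (contDiffOn_rep F) u)
      map_add' := fun F F' => ext_rep fun x hx => by
        rw [rep_add _ _ hx, rep_mk _ hx, rep_mk _ hx, rep_mk _ hx,
          fderiv_congr_of_isOpen hU (fun y hy => rep_add F F' hy) hx,
          fderiv_fun_add (differentiableAt_rep hU F hx) (differentiableAt_rep hU F' hx)]
        rfl
      map_smul' := fun r F => ext_rep fun x hx => by
        rw [RingHom.id_apply, rep_smul _ _ hx, rep_mk _ hx, rep_mk _ hx,
          fderiv_congr_of_isOpen hU (fun y hy => rep_smul r F hy) hx,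
          fderiv_const_mul (differentiableAt_rep hU F hx)]
        rfl }
    fun F F' => ext_rep fun x hx => by
      simp only [LinearMap.coe_mk, AddHom.coe_mk, smul_eq_mul]
      rw [rep_add _ _ hx, rep_mul _ _ hx, rep_mul _ _ hx, rep_mk _ hx, rep_mk _ hx, rep_mk _ hx,
        fderiv_congr_of_isOpen hU (fun y hy => rep_mul F F' hy) hx,
        fderiv_fun_mul (differentiableAt_rep hU F hx) (differentiableAt_rep hU F' hx)]
      simp

theorem rep_dir (hU : IsOpen U) (u : E) (F : Smooth U) {x : E} (hx : x ∈ U) :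
    (rep (dir hU u F)) x = fderiv ℝ (rep F) x u :=
  rep_mk (contDiffOn_fderiv_apply hU (contDiffOn_rep F) u) hx

theorem rep_dir_of_eq (hU : IsOpen U) (u : E) (F : Smooth U) {G : E → ℝ}
    (h : ∀ x ∈ U, rep F x = G x) {x : E} (hx : x ∈ U) :
    (rep (dir hU u F)) x = fderiv ℝ G x u := by
  rw [rep_dir hU u F hx, fderiv_congr_of_isOpen hU h hx]

theorem dir_comm (hU : IsOpen U) (u w : E) (F : Smooth U) :
    dir hU u (dir hU w F) = dir hU w (dir hU u F) := by
  refine ext_rep fun x hx => ?_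
  have hF := contDiffAt_rep hU F hx
  have hd : DifferentiableAt ℝ (fderiv ℝ (rep F)) x :=
    (hF.fderiv_right (m := 1) (by norm_cast)).differentiableAt (by simp)
  have key : ∀ u w : E, (rep (dir hU u (dir hU w F))) x = fderiv ℝ (fderiv ℝ (rep F)) x u w := by
    intro u w
    rw [rep_dir_of_eq hU u _ (fun y hy => rep_dir hU w F hy) hx,
      fderiv_clm_apply hd (differentiableAt_const w)]
    simp
  rw [key, key]
  exact (hF.isSymmSndFDerivAt (by simpa using WithTop.coe_le_coe.2 (le_top (a := (2 : ℕ∞))))) u w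

end Smooth

/-! ### The Helmholtz conditions in an algebra with commuting derivations. -/

/-- A commutative algebra with commuting derivations `T`, `d a`, `e a`, which play the roles of
`∂/∂t`, `∂/∂q^a`, `∂/∂q̇^a`, and elements `v a`, which play the role of the velocities. -/
structure JetDerivations (ι R : Type) [DecidableEq ι] [CommRing R] [Algebra ℝ R] where
  T : Derivation ℝ R R
  d : ι → Derivation ℝ R R
  e : ι → Derivation ℝ R R
  v : ι → R
  d_T : ∀ a x, d a (T x) = T (d a x)
  e_T : ∀ a x, e a (T x) = T (e a x)
  d_d : ∀ a b x, d a (d b x) = d b (d a x)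
  e_d : ∀ a b x, e a (d b x) = d b (e a x)
  e_e : ∀ a b x, e a (e b x) = e b (e a x)
  T_v : ∀ a, T (v a) = 0
  d_v : ∀ a b, d a (v b) = 0
  e_v : ∀ a b, e a (v b) = if a = b then 1 else 0

namespace JetDerivations

variable {ι R : Type} [DecidableEq ι] [CommRing R] [Algebra ℝ R] (J : JetDerivations ι R)

/-- The coefficient of `q̈^c` in `r_ab`. -/
noncomputable def r₁ (g : ι → ι → R) (h : ι → R) (a b c : ι) : R :=
  J.d b (g a c) - J.d a (g b c) + (1 / 2 : ℝ) • J.e c (J.e a (h b) - J.e b (h a))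

/-- The coefficient of `q̈^c` in `s_ab`. -/
noncomputable def s₁ (g : ι → ι → R) (a b c : ι) : R :=
  (1 / 2 : ℝ) • (J.e b (g a c) + J.e a (g b c)) - J.e c (g b a)

variable {J} {g : ι → ι → R} {h : ι → R}

/-- Among `e a (g b c)`, `e b (g a c)`, `e c (g a b)` each is the mean of the other two; subtracting
two such relations gives `3/2` times the difference of two of these terms. -/
theorem e_g_of_s₁_eq_zero (hg : ∀ a b, g a b = g b a) (hs : ∀ a b c, J.s₁ g a b c = 0)
    (a b c : ι) : J.e c (g a b) = J.e b (g a c) := by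
  have h1 := hs a b c
  have h2 := hs a c b
  simp only [s₁, hg b a, hg c a, hg c b] at h1 h2
  -- The coefficients are real scalars acting on `R`, so the normalisation is done by `module`,
  -- after writing `2 * x` as `x + x`.
  linear_combination (norm := ((try simp only [two_mul]); module)) (-2 / 3 : ℝ) • h1 + (2 / 3 : ℝ) • h2

theorem s₁_eq_zero (hg : ∀ a b, g a b = g b a) (he : ∀ a b c, J.e c (g a b) = J.e b (g a c))
    (a b c : ι) : J.s₁ g a b c = 0 := by
  have h1 := he a b c
  have h2 := he b a c
  simp only [s₁, hg b a] at h1 h2 ⊢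
  linear_combination (norm := ((try simp only [two_mul]); module)) (-1 / 2 : ℝ) • h1 + (-1 / 2 : ℝ) • h2

theorem r₁_eq_zero_iff (a b c : ι) : J.r₁ g h a b c = 0 ↔
    J.e b (J.e c (h a)) - J.e a (J.e c (h b)) = 2 * (J.d b (g a c) - J.d a (g b c)) := by
  simp only [r₁, map_sub, J.e_e c]
  constructor
  · intro H
    linear_combination (norm := ((try simp only [two_mul]); module)) (-2 : ℝ) • H
  · intro H
    linear_combination (norm := ((try simp only [two_mul]); module)) (-1 / 2 : ℝ) • H

variable [Fintype ι]

/-- The derivation `∂/∂t + q̇^c ∂/∂q^c`. -/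
noncomputable def Dt (J : JetDerivations ι R) : Derivation ℝ R R := J.T + ∑ c, J.v c • J.d c

variable (J)

theorem Dt_apply (x : R) : J.Dt x = J.T x + ∑ c, J.v c * J.d c x := by
  have h := congrFun (map_sum (Derivation.coeFnAddMonoidHom (R := ℝ) (A := R) (M := R))
    (fun c => J.v c • J.d c) Finset.univ) x
  simp only [Finset.sum_apply] at h
  exact congrArg (J.T x + ·) h

theorem d_Dt (a : ι) (x : R) : J.d a (J.Dt x) = J.Dt (J.d a x) := by
  simp [Dt_apply, map_sum, J.d_T, J.d_v, J.d_d a]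

/-- The extra term comes from the coefficients `q̇^c` of `Dt`. -/
theorem e_Dt (a : ι) (x : R) : J.e a (J.Dt x) = J.Dt (J.e a x) + J.d a x := by
  simp [Dt_apply, map_sum, J.e_T, J.e_v, J.e_d, Finset.sum_add_distrib, add_assoc]

/-- The conditions on the coefficients `g` and `h` of the equations `g_ab q̈^b + h_a = 0`. -/
structure Helmholtz (g : ι → ι → R) (h : ι → R) : Prop where
  symm : ∀ a b, g a b = g b a
  e_g : ∀ a b c, J.e c (g a b) = J.e b (g a c)
  e_e_h : ∀ a b c, J.e b (J.e c (h a)) - J.e a (J.e c (h b))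
    = 2 * (J.d b (g a c) - J.d a (g b c))
  cyclic : ∀ a b c, (J.d b (J.e c (h a)) - J.d c (J.e b (h a)))
    + (J.d c (J.e a (h b)) - J.d a (J.e c (h b)))
    + (J.d a (J.e b (h c)) - J.d b (J.e a (h c))) = 0

/-- The part of `r_ab` that does not contain the accelerations. -/
noncomputable def r (h : ι → R) (a b : ι) : R :=
  J.d b (h a) - J.d a (h b) + (1 / 2 : ℝ) • J.Dt (J.e a (h b) - J.e b (h a))

/-- The part of `s_ab` that does not contain the accelerations. -/
noncomputable def s (g : ι → ι → R) (h : ι → R) (a b : ι) : R :=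
  (1 / 2 : ℝ) • (J.e b (h a) + J.e a (h b)) - J.Dt (g b a)

variable {J}

/-- The terms under `Dt` cancel by `Dt` applied to `he`; what remains of the difference of the two
sides is half the cyclic sum. -/
theorem e_r_eq_iff (he : ∀ a b c, J.e b (J.e c (h a)) - J.e a (J.e c (h b))
    = 2 * (J.d b (g a c) - J.d a (g b c))) (hg : ∀ a b, g a b = g b a) (a b c : ι) :
    J.e c (J.r h a b) = J.d b (J.s g h a c) - J.d a (J.s g h b c) ↔
    (J.d b (J.e c (h a)) - J.d c (J.e b (h a)))
    + (J.d c (J.e a (h b)) - J.d a (J.e c (h b)))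
    + (J.d a (J.e b (h c)) - J.d b (J.e a (h c))) = 0 := by
  have h1 := congrArg J.Dt (he a b c)
  simp only [two_mul, map_add, map_sub] at h1
  simp only [r, s, map_add, map_sub, Derivation.map_smul, e_Dt, d_Dt, J.e_d, J.e_e c, hg c]
  constructor
  · intro H
    linear_combination (norm := ((try simp only [two_mul]); module)) (2 : ℝ) • H + h1
  · intro H
    linear_combination (norm := ((try simp only [two_mul]); module)) (1 / 2 : ℝ) • H - (1 / 2 : ℝ) • h1

/-- The terms under `Dt` agree by `e_g`, and the commutator terms `d c (g a b)`, `d b (g a c)` are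
balanced by half of `e_e_h`. -/
theorem Helmholtz.e_s (H : J.Helmholtz g h) (a b c : ι) :
    J.e c (J.s g h a b) = J.e b (J.s g h a c) := by
  have h1 := H.e_e_h b c a
  have h2 := congrArg J.Dt (H.e_g a b c)
  simp only [s, map_add, map_sub, Derivation.map_smul, e_Dt, H.symm b a, H.symm c a, h2,
    J.e_e c b]
  simp only [H.symm b a, H.symm c a, J.e_e b a, J.e_e c a] at h1 ⊢
  linear_combination (norm := ((try simp only [two_mul]); module)) (1 / 2 : ℝ) • h1

/-- The second position derivatives of `h` cancel in the cyclic sum, leaving half of `Dt` of the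
cyclic condition. -/
theorem Helmholtz.d_r (H : J.Helmholtz g h) (a b c : ι) :
    J.d c (J.r h a b) + J.d a (J.r h b c) + J.d b (J.r h c a) = 0 := by
  have h1 := congrArg J.Dt (H.cyclic a b c)
  simp only [map_add, map_sub, map_zero] at h1
  simp only [r, map_add, map_sub, Derivation.map_smul, d_Dt]
  rw [J.d_d c b, J.d_d c a, J.d_d a b]
  linear_combination (norm := ((try simp only [two_mul]); module)) (1 / 2 : ℝ) • h1

variable (J) in
/-- The coefficients `g` and `h` come from a Lagrangian `Λ` and a dissipation potential `D`. -/
def IsLagrangian (g : ι → ι → R) (h : ι → R) (Λ D : R) : Prop :=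
  (∀ a b, g a b = J.e b (J.e a Λ)) ∧ ∀ a, h a = J.Dt (J.e a Λ) - J.d a Λ + J.e a D

theorem IsLagrangian.helmholtz {Λ D : R} (H : J.IsLagrangian g h Λ D) : J.Helmholtz g h where
  symm a b := by rw [H.1, H.1, J.e_e]
  e_g a b c := by rw [H.1, H.1, J.e_e]
  e_e_h a b c := by
    simp only [H.1, H.2, map_add, map_sub, e_Dt, J.e_d]
    simp only [J.e_e c b, J.e_e c a, J.e_e b a]
    ring
  cyclic a b c := by
    simp only [H.2, map_add, map_sub, e_Dt, d_Dt, J.e_d]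
    simp only [J.e_e c b, J.e_e c a, J.e_e b a, J.d_d c b, J.d_d c a, J.d_d b a]
    ring

/-- `hP₁` is the Poincaré lemma for 1-forms in the velocities, `hP₂` the one for
velocity-independent 2-forms in the positions. As hypotheses they keep the analysis out of the
algebra. -/
theorem Helmholtz.exists_isLagrangian
    (hP₁ : ∀ p : ι → R, (∀ a b, J.e b (p a) = J.e a (p b)) → ∃ K, ∀ a, J.e a K = p a)
    (hP₂ : ∀ w : ι → ι → R, (∀ a b, w b a = -w a b) → (∀ a b c, J.e c (w a b) = 0) →
      (∀ a b c, J.d a (w b c) + J.d b (w c a) + J.d c (w a b) = 0) →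
      ∃ α : ι → R, (∀ a b, J.e b (α a) = 0) ∧ ∀ a b, J.d a (α b) - J.d b (α a) = w a b)
    (H : J.Helmholtz g h) : ∃ Λ D, J.IsLagrangian g h Λ D := by
  -- Each row of `g` is a velocity gradient, of `p a`; by the symmetry of `g`, `p` is itself a
  -- gradient, so `g` is the Hessian of `K`.
  choose p hp using fun a => hP₁ (g a) (fun b c => H.e_g a b c)
  obtain ⟨K, hK⟩ := hP₁ p (fun a b => by rw [hp, hp, H.symm])
  have hg : ∀ a b, J.e b (J.e a K) = g a b := fun a b => by rw [hK, hp]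
  -- The remainder of `h` after the acceleration-free part of the Euler–Lagrange expression of `K`
  -- is removed.
  set k : ι → R := fun a => h a - J.Dt (J.e a K) + J.d a K with hk
  have hek : ∀ a b, J.e b (k a) - J.e a (k b) =
      J.e b (h a) - J.e a (h b) - 2 * J.d b (J.e a K) + 2 * J.d a (J.e b K) := by
    intro a b
    simp only [hk, map_add, map_sub, e_Dt, J.e_d, J.e_e b a]
    ring
  -- `e_e_h` says that the velocity curl of `k` is velocity-independent, and `cyclic` that it is
  -- closed in the positions.
  obtain ⟨β, hβe, hβ⟩ := hP₂ (fun b a => J.e b (k a) - J.e a (k b)) (fun a b => by ring)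
    (fun b a c => by
      have h1 := H.e_e_h a b c
      simp only [hek, two_mul, map_add, map_sub, J.e_d, hg, J.e_e c b, J.e_e c a]
      linear_combination h1)
    (fun a b c => by
      have h1 := H.cyclic a b c
      simp only [hek, two_mul, map_add, map_sub]
      rw [J.d_d b a, J.d_d c a, J.d_d c b]
      linear_combination h1)
  -- The Euler–Lagrange expression of `α_b q̇^b` has velocity derivative `d b (α a) - d a (α b)`,
  -- already antisymmetric, so its velocity curl is twice that; hence the factor `1/2`.
  set α : ι → R := fun a => (1 / 2 : ℝ) • β a with hα
  have hαe : ∀ a b, J.e b (α a) = 0 := fun a b => by simp [hα, hβe]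
  have hαd : ∀ a b, J.e b (k a) - J.e a (k b) = 2 * (J.d b (α a) - J.d a (α b)) := by
    intro a b
    simp only [hα, Derivation.map_smul]
    linear_combination (norm := ((try simp only [two_mul]); module)) -hβ b a
  obtain ⟨D, hD⟩ := hP₁ (fun a => k a - (J.Dt (α a) - ∑ b, J.v b * J.d a (α b))) (by
    intro a b
    have h1 := hαd a b
    simp only [map_sub, map_sum, e_Dt, hαe, map_zero, Derivation.leibniz, J.e_v, J.e_d,
      smul_eq_mul, Finset.sum_add_distrib, mul_ite, mul_one, mul_zero, Finset.sum_ite_eq,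
      Finset.mem_univ, if_true, Finset.sum_const_zero]
    linear_combination h1)
  refine ⟨K + ∑ b, α b * J.v b, D, fun a b => ?_, fun a => ?_⟩
  · simp [map_sum, hαe, J.e_v, hg]
  · have h1 : J.e a (K + ∑ b, α b * J.v b) = J.e a K + α a := by simp [map_sum, hαe, J.e_v]
    have h2 : J.d a (K + ∑ b, α b * J.v b) = J.d a K + ∑ b, J.v b * J.d a (α b) := by
      simp [map_sum, J.d_v]
    rw [h1, h2, hD]
    simp only [hk, map_add]
    ring

end JetDerivations

/-! ### The homotopy operator contracting one group of coordinates. -/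

namespace Smooth

variable {E : Type} [NormedAddCommGroup E] [NormedSpace ℝ E] {U : Set E}

/-- The point reached at time `τ` on the segment from `x - (N x - c)` to `x`. -/
def segment (N : E →L[ℝ] E) (c x : E) (τ : ℝ) : E := x + (τ - 1) • (N x - c)

variable {N : E →L[ℝ] E} {c : E}

theorem contDiff_segment : ContDiff ℝ ∞ (fun p : E × ℝ => segment N c p.1 p.2) := by
  unfold segment
  fun_prop

theorem hasFDerivAt_segment (x : E) (τ : ℝ) :
    HasFDerivAt (fun y => segment N c y τ) (ContinuousLinearMap.id ℝ E + (τ - 1) • N) x :=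
  (hasFDerivAt_id x).add ((N.hasFDerivAt.sub_const c).const_smul (τ - 1))

theorem hasDerivAt_segment (x : E) (τ : ℝ) :
    HasDerivAt (fun τ => segment N c x τ) (N x - c) τ := by
  unfold segment
  simpa using (((hasDerivAt_id τ).sub_const 1).smul_const (N x - c)).const_add x

theorem contDiffOn_segment_integrand (F : Smooth U) (m : ℕ) :
    ContDiffOn ℝ ∞ (fun p : E × ℝ => p.2 ^ m * rep F (segment N c p.1 p.2))
      ((fun p : E × ℝ => segment N c p.1 p.2) ⁻¹' U) :=
  (contDiff_snd.pow m).contDiffOn.mul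
    ((contDiffOn_rep F).comp contDiff_segment.contDiffOn fun _ h => h)

theorem intervalIntegrable_segment
    (hc : ∀ x ∈ U, ∀ τ ∈ Set.Icc (0 : ℝ) 1, segment N c x τ ∈ U) (F : Smooth U) (m : ℕ) {x : E}
    (hx : x ∈ U) : IntervalIntegrable (fun τ => τ ^ m * rep F (segment N c x τ))
      MeasureTheory.volume 0 1 := by
  refine ContinuousOn.intervalIntegrable ?_
  rw [Set.uIcc_of_le zero_le_one]
  exact (contDiffOn_segment_integrand F m).continuousOn.comp (f := fun τ : ℝ => (x, τ))
    (by fun_prop) (hc x hx)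

variable [LocallyCompactSpace E]

theorem contDiffOn_integral_segment (hU : IsOpen U)
    (hc : ∀ x ∈ U, ∀ τ ∈ Set.Icc (0 : ℝ) 1, segment N c x τ ∈ U) (F : Smooth U) (m : ℕ) :
    ContDiffOn ℝ ∞ (fun x => ∫ τ in (0 : ℝ)..1, τ ^ m * rep F (segment N c x τ)) U :=
  contDiffOn_infty.2 fun k => contDiffOn_intervalIntegral
    (hU.preimage contDiff_segment.continuous) hU hc k (contDiffOn_segment_integrand F m)

/-- The homotopy operator `F ↦ ∫₀¹ τ^m F(segment x τ) dτ` of the Poincaré lemma. -/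
noncomputable def contract (hU : IsOpen U)
    (hc : ∀ x ∈ U, ∀ τ ∈ Set.Icc (0 : ℝ) 1, segment N c x τ ∈ U) (m : ℕ) :
    Smooth U →ₗ[ℝ] Smooth U where
  toFun F := mk _ (contDiffOn_integral_segment hU hc F m)
  map_add' F F' := ext_rep fun x hx => by
    rw [rep_add _ _ hx, rep_mk _ hx, rep_mk _ hx, rep_mk _ hx, ← intervalIntegral.integral_add
      (intervalIntegrable_segment hc F m hx) (intervalIntegrable_segment hc F' m hx)]
    refine intervalIntegral.integral_congr fun τ hτ => ?_
    rw [Set.uIcc_of_le zero_le_one] at hτ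
    simp only [rep_add _ _ (hc x hx τ hτ), mul_add]
  map_smul' r F := ext_rep fun x hx => by
    rw [RingHom.id_apply, rep_smul _ _ hx, rep_mk _ hx, rep_mk _ hx,
      ← intervalIntegral.integral_const_mul]
    refine intervalIntegral.integral_congr fun τ hτ => ?_
    rw [Set.uIcc_of_le zero_le_one] at hτ
    simp only [rep_smul _ _ (hc x hx τ hτ)]
    ring

variable (hU : IsOpen U) (hc : ∀ x ∈ U, ∀ τ ∈ Set.Icc (0 : ℝ) 1, segment N c x τ ∈ U)

theorem rep_contract (m : ℕ) (F : Smooth U) {x : E} (hx : x ∈ U) :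
    rep (contract hU hc m F) x = ∫ τ in (0 : ℝ)..1, τ ^ m * rep F (segment N c x τ) :=
  rep_mk (contDiffOn_integral_segment hU hc F m) hx

/-- Differentiation under the integral and the chain rule: the segment map has derivative `id + (τ -
1) N` in the base point. -/
theorem rep_dir_contract (m : ℕ) (F : Smooth U) (u : E) {x : E} (hx : x ∈ U) :
    rep (dir hU u (contract hU hc m F)) x =
      ∫ τ in (0 : ℝ)..1, τ ^ m * fderiv ℝ (rep F) (segment N c x τ) (u + (τ - 1) • N u) := by
  have hW := hU.preimage (contDiff_segment (N := N) (c := c)).continuous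
  have hF := contDiffOn_segment_integrand (N := N) (c := c) F m
  rw [rep_dir_of_eq hU u _ (fun y hy => rep_contract hU hc m F hy) hx,
    (hasFDerivAt_intervalIntegral_of_contDiffOn hW hF (hc x hx)).fderiv,
    ContinuousLinearMap.intervalIntegral_apply]
  · refine intervalIntegral.integral_congr fun τ hτ => ?_
    rw [Set.uIcc_of_le zero_le_one] at hτ
    have h1 := (((hF.contDiffAt (hW.mem_nhds (hc x hx τ hτ))).differentiableAt
      (by simp)).hasFDerivAt).comp x (hasFDerivAt_prodMk_left x τ)
    have h2 := ((((differentiableAt_rep hU F (hc x hx τ hτ)).hasFDerivAt).comp x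
      (hasFDerivAt_segment x τ)).const_mul (τ ^ m))
    have h3 := congrArg (fun L => L u) (h1.unique h2)
    simpa [mul_add] using h3
  · refine ContinuousOn.intervalIntegrable ?_
    rw [Set.uIcc_of_le zero_le_one]
    exact ((hF.continuousOn_fderiv_of_isOpen hW (by simp)).clm_comp continuousOn_const).comp
      (f := fun τ : ℝ => (x, τ)) (by fun_prop) (hc x hx)

/-- A contracted direction is scaled by `τ`, which raises the weight by one. -/
theorem dir_contract_of_eq_self (m : ℕ) (F : Smooth U) {u : E} (hu : N u = u) :
    dir hU u (contract hU hc m F) = contract hU hc (m + 1) (dir hU u F) :=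
  ext_rep fun x hx => by
    rw [rep_dir_contract hU hc m F u hx, rep_contract hU hc _ _ hx]
    refine intervalIntegral.integral_congr fun τ hτ => ?_
    rw [Set.uIcc_of_le zero_le_one] at hτ
    simp only [rep_dir hU u F (hc x hx τ hτ), hu, map_add, map_smul, smul_eq_mul]
    ring

theorem dir_contract_of_eq_zero (m : ℕ) (F : Smooth U) {u : E} (hu : N u = 0) :
    dir hU u (contract hU hc m F) = contract hU hc m (dir hU u F) :=
  ext_rep fun x hx => by
    rw [rep_dir_contract hU hc m F u hx, rep_contract hU hc _ _ hx]
    refine intervalIntegral.integral_congr fun τ hτ => ?_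
    rw [Set.uIcc_of_le zero_le_one] at hτ
    simp [rep_dir hU u F (hc x hx τ hτ), hu]

/-- The integrand is the `τ`-derivative of `τ ^ (m + 1) * F (segment x τ)`, which is `F x` at `τ =
1` and vanishes at `τ = 0` because the exponent is positive. -/
theorem contract_add_sum_mul_contract {ι : Type} [Fintype ι] {u : ι → E} {w : ι → Smooth U}
    (hw : ∀ x ∈ U, N x - c = ∑ b, rep (w b) x • u b) (m : ℕ) (F : Smooth U) :
    ((m : ℝ) + 1) • contract hU hc m F
      + ∑ b, w b * contract hU hc (m + 1) (dir hU (u b) F) = F := by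
  refine ext_rep fun x hx => ?_
  simp only [rep_add _ _ hx, rep_smul _ _ hx, rep_sum _ _ hx, rep_mul _ _ hx,
    rep_contract hU hc _ _ hx, ← intervalIntegral.integral_const_mul]
  have hs : IntervalIntegrable (fun τ => ∑ b, rep (w b) x *
      (τ ^ (m + 1) * rep (dir hU (u b) F) (segment N c x τ))) MeasureTheory.volume 0 1 := by
    have h := IntervalIntegrable.sum Finset.univ fun b _ =>
      (intervalIntegrable_segment hc (dir hU (u b) F) (m + 1) hx).const_mul (rep (w b) x)
    simpa only [Finset.sum_fn] using h
  rw [← intervalIntegral.integral_finsetSum fun b _ =>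
      (intervalIntegrable_segment hc _ _ hx).const_mul _,
    ← intervalIntegral.integral_add ((intervalIntegrable_segment hc _ _ hx).const_mul _) hs]
  have hd : ∀ τ ∈ Set.uIcc (0 : ℝ) 1, HasDerivAt
      (fun τ => τ ^ (m + 1) * rep F (segment N c x τ))
      (((m : ℝ) + 1) * (τ ^ m * rep F (segment N c x τ)) + ∑ b, rep (w b) x *
        (τ ^ (m + 1) * rep (dir hU (u b) F) (segment N c x τ))) τ := by
    intro τ hτ
    rw [Set.uIcc_of_le zero_le_one] at hτ
    have h1 := ((differentiableAt_rep hU F (hc x hx τ hτ)).hasFDerivAt).comp_hasDerivAt τ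
      (hasDerivAt_segment x τ)
    refine ((hasDerivAt_pow (m + 1) τ).mul h1).congr_deriv ?_
    rw [hw x hx, map_sum, Finset.mul_sum]
    simp only [map_smul, smul_eq_mul, rep_dir hU _ F (hc x hx τ hτ)]
    push_cast
    simp only [Function.comp]
    congr 1
    · ring
    · exact Finset.sum_congr rfl fun b _ => by ring
  rw [intervalIntegral.integral_eq_sub_of_hasDerivAt hd]
  · simp [segment]
  · exact ((intervalIntegrable_segment hc _ _ hx).const_mul _).add hs

end Smooth

/-! ### Coordinates and partial derivatives on first-order jets. -/

theorem isOpen_dom1 {n : ℕ} {I : Set ℝ} {Q V : Set (Fin n → ℝ)} (hI : IsOpen I) (hQ : IsOpen Q)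
    (hV : IsOpen V) : IsOpen (dom1 I Q V) :=
  (hI.preimage (by fun_prop : Continuous fun p : Jet 1 n => p.1)).inter
    ((hQ.preimage (by fun_prop : Continuous fun p : Jet 1 n => p.2 0)).inter
      (hV.preimage (by fun_prop : Continuous fun p : Jet 1 n => p.2 1)))

theorem isOpen_dom2 {n : ℕ} {I : Set ℝ} {Q V A : Set (Fin n → ℝ)} (hI : IsOpen I) (hQ : IsOpen Q)
    (hV : IsOpen V) (hA : IsOpen A) : IsOpen (dom2 I Q V A) :=
  (hI.preimage (by fun_prop : Continuous fun p : Jet 2 n => p.1)).inter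
    ((hQ.preimage (by fun_prop : Continuous fun p : Jet 2 n => p.2 0)).inter
      ((hV.preimage (by fun_prop : Continuous fun p : Jet 2 n => p.2 1)).inter
        (hA.preimage (by fun_prop : Continuous fun p : Jet 2 n => p.2 2))))

/-- The unit vector in the direction of the `a`-th coordinate of order `i`. -/
def jetUnit {k n : ℕ} (i : Fin (k + 1)) (a : Fin n) : Jet k n := (0, Pi.single i (Pi.single a 1))

theorem contDiff_jetCoord {k n : ℕ} (i : Fin (k + 1)) (a : Fin n) :
    ContDiff ℝ ∞ (fun x : Jet k n => x.2 i a) := by fun_prop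

theorem fderiv_jetCoord {k n : ℕ} (i : Fin (k + 1)) (a : Fin n) (x u : Jet k n) :
    fderiv ℝ (fun x : Jet k n => x.2 i a) x u = u.2 i a := by
  let L : Jet k n →L[ℝ] ℝ := ((ContinuousLinearMap.proj (R := ℝ) (φ := fun _ : Fin n => ℝ) a).comp
    (ContinuousLinearMap.proj (R := ℝ) (φ := fun _ : Fin (k + 1) => Fin n → ℝ) i)).comp
    (ContinuousLinearMap.snd ℝ ℝ (Fin (k + 1) → Fin n → ℝ))
  exact congrArg (fun M => M u) (L.hasFDerivAt (x := x)).fderiv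

section

open Smooth

variable {n : ℕ} {U : Set (Jet 1 n)} (hU : IsOpen U)

/-- The coordinate functions on a set of first-order jets. -/
noncomputable def jetCoord (U : Set (Jet 1 n)) (i : Fin 2) (a : Fin n) : Smooth U :=
  mk (fun x => x.2 i a) (contDiff_jetCoord i a).contDiffOn

theorem rep_jetCoord (i : Fin 2) (a : Fin n) {x : Jet 1 n} (hx : x ∈ U) :
    rep (jetCoord U i a) x = x.2 i a := rep_mk (contDiff_jetCoord i a).contDiffOn hx

theorem rep_dir_jetCoord (u : Jet 1 n) (i : Fin 2) (a : Fin n) {x : Jet 1 n} (hx : x ∈ U) :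
    rep (dir hU u (jetCoord U i a)) x = u.2 i a := by
  rw [rep_dir_of_eq hU u _ (fun y hy => rep_jetCoord i a hy) hx,
    fderiv_jetCoord]

theorem dir_jetCoord_eq_zero {u : Jet 1 n} {i : Fin 2} (a : Fin n) (h : u.2 i = 0) :
    dir hU u (jetCoord U i a) = 0 :=
  ext_rep fun x hx => by rw [rep_dir_jetCoord hU u i a hx, rep_zero hx, h]; rfl

theorem dir_jetUnit_jetCoord (i : Fin 2) (a b : Fin n) :
    dir hU (jetUnit i a) (jetCoord U i b) = if a = b then 1 else 0 :=
  ext_rep fun x hx => by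
    rw [rep_dir_jetCoord hU _ i b hx]
    split_ifs with h
    · simp [jetUnit, rep_one hx, h]
    · simp [jetUnit, rep_zero hx, Ne.symm h]

/-- The partial derivatives of smooth functions of first order. -/
noncomputable def jetDerivations : JetDerivations (Fin n) (Smooth U) where
  T := dir hU (1, 0)
  d a := dir hU (jetUnit 0 a)
  e a := dir hU (jetUnit 1 a)
  v a := jetCoord U 1 a
  d_T a x := dir_comm ..
  e_T a x := dir_comm ..
  d_d a b x := dir_comm ..
  e_d a b x := dir_comm ..
  e_e a b x := dir_comm ..
  T_v a := dir_jetCoord_eq_zero hU a rfl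
  d_v a b := dir_jetCoord_eq_zero hU b (by simp [jetUnit])
  e_v a b := dir_jetUnit_jetCoord hU 1 a b

/-- The projection to the coordinates of order `i`. -/
noncomputable def orderProj (n : ℕ) (i : Fin 2) : Jet 1 n →L[ℝ] Jet 1 n :=
  (ContinuousLinearMap.inr ℝ ℝ (Fin 2 → Fin n → ℝ)).comp
    ((ContinuousLinearMap.single ℝ (fun _ : Fin 2 => Fin n → ℝ) i).comp
      ((ContinuousLinearMap.proj (R := ℝ) (φ := fun _ : Fin 2 => Fin n → ℝ) i).comp
        (ContinuousLinearMap.snd ℝ ℝ (Fin 2 → Fin n → ℝ))))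

theorem orderProj_apply (i : Fin 2) (x : Jet 1 n) :
    orderProj n i x = (0, Pi.single i (x.2 i)) := rfl

theorem orderProj_jetUnit (i : Fin 2) (a : Fin n) :
    orderProj n i (jetUnit i a) = jetUnit i a := by
  simp [orderProj_apply, jetUnit]

theorem orderProj_jetUnit_of_ne {i j : Fin 2} (h : i ≠ j) (a : Fin n) :
    orderProj n i (jetUnit j a) = 0 := by
  simp [orderProj_apply, jetUnit, Pi.single_eq_of_ne h]

theorem orderProj_sub_eq_sum (i : Fin 2) (c₀ : Fin n → ℝ) {x : Jet 1 n} (hx : x ∈ U) :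
    orderProj n i x - (0, Pi.single i c₀) =
      ∑ b, rep (jetCoord U i b - algebraMap ℝ _ (c₀ b)) x • (jetUnit i b : Jet 1 n) := by
  have h : ∀ b, rep (jetCoord U i b - algebraMap ℝ _ (c₀ b)) x = (x.2 i - c₀) b := fun b => by
    rw [rep_sub _ _ hx, rep_jetCoord i b hx, rep_apply _ hx]
    rfl
  simp only [h, orderProj_apply, jetUnit]
  ext j a
  · simp [Prod.fst_sum]
  · by_cases hj : j = i
    · subst hj
      simp [Prod.snd_sum, Finset.sum_apply, Pi.single_apply]
    · simp [Prod.snd_sum, Finset.sum_apply, Pi.single_eq_of_ne hj]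

/-- The Poincaré lemma for 1-forms in the velocities, with time and positions as parameters.
Closedness turns `∂K/∂q̇^a` into the left side of `contract_add_sum_mul_contract` with `m = 0`. -/
theorem exists_potential {v₀ : Fin n → ℝ}
    (hc : ∀ x ∈ U, ∀ τ ∈ Set.Icc (0 : ℝ) 1, segment (orderProj n 1) (0, Pi.single 1 v₀) x τ ∈ U)
    (p : Fin n → Smooth U)
    (hp : ∀ a b, (jetDerivations hU).e b (p a) = (jetDerivations hU).e a (p b)) :
    ∃ K, ∀ a, (jetDerivations hU).e a K = p a := by
  refine ⟨∑ b, (jetCoord U 1 b - algebraMap ℝ _ (v₀ b)) * contract hU hc 0 (p b), fun a => ?_⟩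
  have h1 : ∀ b, (jetDerivations hU).e a (contract hU hc 0 (p b)) =
      contract hU hc 1 ((jetDerivations hU).e b (p a)) := fun b => by
    rw [hp a b]
    exact dir_contract_of_eq_self hU hc 0 (p b) (orderProj_jetUnit 1 a)
  have h2 := contract_add_sum_mul_contract hU hc
    (fun x hx => orderProj_sub_eq_sum (U := U) 1 v₀ hx) 0 (p a)
  have h3 : ∀ b, (jetDerivations hU).e a (jetCoord U 1 b) = if a = b then 1 else 0 :=
    fun b => dir_jetUnit_jetCoord hU 1 a b
  simp only [map_sum, Derivation.leibniz, h1, map_sub, h3, Derivation.map_algebraMap, sub_zero,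
    smul_eq_mul, Finset.sum_add_distrib, mul_ite, mul_one, mul_zero, Finset.sum_ite_eq,
    Finset.mem_univ, if_true]
  refine (add_comm _ _).trans ?_
  simp only [Nat.cast_zero, zero_add, one_smul] at h2
  exact h2

/-- The Poincaré lemma for 2-forms in the positions. The weight is `τ` (`m = 1`) because the degree
is two: `d a (α b)` and `-d b (α a)` each contribute one `contract 1 (w a b)`, matching the factor
`m + 1 = 2`. The contraction fixes the velocities, so `α` inherits independence of them from `w`. -/
theorem exists_potential_of_closed {q₀ : Fin n → ℝ}
    (hc : ∀ x ∈ U, ∀ τ ∈ Set.Icc (0 : ℝ) 1, segment (orderProj n 0) (0, Pi.single 0 q₀) x τ ∈ U)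
    (w : Fin n → Fin n → Smooth U) (hw : ∀ a b, w b a = -w a b)
    (hwe : ∀ a b c, (jetDerivations hU).e c (w a b) = 0)
    (hwd : ∀ a b c, (jetDerivations hU).d a (w b c) + (jetDerivations hU).d b (w c a)
      + (jetDerivations hU).d c (w a b) = 0) :
    ∃ α : Fin n → Smooth U, (∀ a b, (jetDerivations hU).e b (α a) = 0) ∧
      ∀ a b, (jetDerivations hU).d a (α b) - (jetDerivations hU).d b (α a) = w a b := by
  refine ⟨fun a => ∑ b, (jetCoord U 0 b - algebraMap ℝ _ (q₀ b)) * contract hU hc 1 (w b a),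
    fun a b => ?_, fun a b => ?_⟩
  · have h1 : ∀ c, (jetDerivations hU).e b (contract hU hc 1 (w c a)) = 0 := fun c => by
      have h := dir_contract_of_eq_zero hU hc 1 (w c a)
        (orderProj_jetUnit_of_ne (i := 0) (j := 1) (by decide) b)
      exact h.trans ((congrArg _ (hwe c a b)).trans (map_zero _))
    have h2 : ∀ c, (jetDerivations hU).e b (jetCoord U 0 c) = 0 :=
      fun c => dir_jetCoord_eq_zero hU c (by simp [jetUnit])
    simp [map_sum, h1, h2]
  · have h1 : ∀ a b c, (jetDerivations hU).d a (contract hU hc 1 (w c b)) =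
        contract hU hc 2 ((jetDerivations hU).d a (w c b)) := fun a b c =>
      dir_contract_of_eq_self hU hc 1 (w c b) (orderProj_jetUnit 0 a)
    have h2 := contract_add_sum_mul_contract hU hc
      (fun x hx => orderProj_sub_eq_sum (U := U) 0 q₀ hx) 1 (w a b)
    have h3 : ∀ a b, (jetDerivations hU).d a (jetCoord U 0 b) = if a = b then 1 else 0 :=
      fun a b => dir_jetUnit_jetCoord hU 0 a b
    have h4 : ∀ c, contract hU hc 2 (dir hU (jetUnit 0 c) (w a b)) =
        contract hU hc 2 ((jetDerivations hU).d a (w c b))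
          - contract hU hc 2 ((jetDerivations hU).d b (w c a)) := fun c => by
      have h := hwd a b c
      rw [hw c b, map_neg] at h
      rw [← map_sub]
      refine congrArg _ ?_
      change (jetDerivations hU).d c (w a b) = _
      linear_combination h
    simp only [map_sum, Derivation.leibniz, h1, map_sub, h3, Derivation.map_algebraMap, sub_zero,
      smul_eq_mul, Finset.sum_add_distrib, mul_ite, mul_one, mul_zero, Finset.sum_ite_eq,
      Finset.mem_univ, if_true]
    simp only [Nat.reduceAdd, h4, mul_sub, Finset.sum_sub_distrib] at h2
    rw [hw a b, map_neg]
    rw [show ((1 : ℕ) : ℝ) + 1 = 2 by norm_num, two_smul] at h2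
    linear_combination h2

end

theorem segment_mem_of_starConvex {m : ℕ} {S : Set (Fin m → ℝ)} {c : Fin m → ℝ}
    (hS : StarConvex ℝ c S) {y : Fin m → ℝ} (hy : y ∈ S) {τ : ℝ} (hτ : τ ∈ Set.Icc (0 : ℝ) 1) :
    y + (τ - 1) • (y - c) ∈ S := by
  have h := hS hy (sub_nonneg.2 hτ.2) hτ.1 (by ring)
  convert h using 1
  module

theorem segment_mem_dom1 {n : ℕ} {I : Set ℝ} {Q V : Set (Fin n → ℝ)} {q₀ v₀ : Fin n → ℝ}
    (hQs : StarConvex ℝ q₀ Q) (hVs : StarConvex ℝ v₀ V) {x : Jet 1 n} (hx : x ∈ dom1 I Q V)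
    {τ : ℝ} (hτ : τ ∈ Set.Icc (0 : ℝ) 1) :
    Smooth.segment (orderProj n 0) (0, Pi.single 0 q₀) x τ ∈ dom1 I Q V ∧
      Smooth.segment (orderProj n 1) (0, Pi.single 1 v₀) x τ ∈ dom1 I Q V := by
  obtain ⟨h1, h2, h3⟩ := hx
  refine ⟨⟨?_, ?_, ?_⟩, ?_, ?_, ?_⟩
  · simpa [Smooth.segment, orderProj_apply] using h1
  · simpa [Smooth.segment, orderProj_apply] using segment_mem_of_starConvex hQs h2 hτ
  · simpa [Smooth.segment, orderProj_apply] using h3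
  · simpa [Smooth.segment, orderProj_apply] using h1
  · simpa [Smooth.segment, orderProj_apply] using h2
  · simpa [Smooth.segment, orderProj_apply] using segment_mem_of_starConvex hVs h3 hτ

/-! ### Forgetting and adding the highest-order coordinates. -/

section

variable {k n : ℕ}

/-- `jetProj` as a continuous linear map. -/
def jetProjL (k n : ℕ) : Jet (k + 1) n →L[ℝ] Jet k n :=
  (ContinuousLinearMap.fst ℝ ℝ (Fin (k + 2) → Fin n → ℝ)).prod
    ((ContinuousLinearMap.pi fun i : Fin (k + 1) =>
      ContinuousLinearMap.proj (R := ℝ) (φ := fun _ : Fin (k + 2) => Fin n → ℝ) i.castSucc).comp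
      (ContinuousLinearMap.snd ℝ ℝ (Fin (k + 2) → Fin n → ℝ)))

theorem hasFDerivAt_jetProj (p : Jet (k + 1) n) : HasFDerivAt jetProj (jetProjL k n) p :=
  (jetProjL k n).hasFDerivAt

theorem contDiff_jetProj : ContDiff ℝ ∞ (jetProj : Jet (k + 1) n → Jet k n) :=
  (jetProjL k n).contDiff

theorem jetProj_jetUnit (i : Fin (k + 1)) (a : Fin n) :
    jetProj (jetUnit i.castSucc a) = jetUnit i a := by
  refine Prod.ext rfl (funext fun j => ?_)
  simp [jetProj, jetUnit, Pi.single_apply]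

theorem jetProj_jetUnit_last (a : Fin n) :
    jetProj (jetUnit (Fin.last (k + 1)) a) = (0 : Jet k n) := by
  refine Prod.ext rfl (funext fun j => ?_)
  simp [jetProj, jetUnit]

theorem fderiv_comp_jetProj {F : Jet k n → ℝ} {p : Jet (k + 1) n}
    (hF : DifferentiableAt ℝ F (jetProj p)) (u : Jet (k + 1) n) :
    fderiv ℝ (fun p => F (jetProj p)) p u = fderiv ℝ F (jetProj p) (jetProj u) :=
  congrArg (fun L => L u) (hF.hasFDerivAt.comp p (hasFDerivAt_jetProj p)).fderiv

/-- The projection kills the directions of highest order, so the new top-order terms of the total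
derivative drop out. -/
theorem totalDeriv_comp_jetProj {F : Jet k n → ℝ} {p : Jet (k + 2) n}
    (hF : DifferentiableAt ℝ F (jetProj (jetProj p))) :
    totalDeriv (fun p => F (jetProj p)) p = totalDeriv F (jetProj p) := by
  simp only [totalDeriv, pdT, pd, fderiv_comp_jetProj hF]
  rw [Fin.sum_univ_castSucc]
  have h1 : ∀ c : Fin n, jetProj ((0, Pi.single (Fin.last (k + 1)) (Pi.single c 1)) :
    Jet (k + 1) n) = 0 := jetProj_jetUnit_last
  have h2 : ∀ (i : Fin (k + 1)) (c : Fin n), jetProj ((0, Pi.single i.castSucc (Pi.single c 1)) :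
    Jet (k + 1) n) = (0, Pi.single i (Pi.single c 1)) := jetProj_jetUnit
  simp only [h1, h2, map_zero, mul_zero, Finset.sum_const_zero, add_zero]
  rfl

theorem totalDeriv_congr {S : Set (Jet k n)} (hS : IsOpen S) {F G : Jet k n → ℝ}
    (h : ∀ x ∈ S, F x = G x) {p : Jet (k + 1) n} (hp : jetProj p ∈ S) :
    totalDeriv F p = totalDeriv G p := by
  simp only [totalDeriv, pdT, pd, Smooth.fderiv_congr_of_isOpen hS h hp]

/-- Extend a jet by coordinates of the next order. -/
def jetExt (x : Jet k n) (y : Fin n → ℝ) : Jet (k + 1) n :=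
  (x.1, Fin.snoc (α := fun _ => Fin n → ℝ) x.2 y)

theorem jetExt_castSucc (x : Jet k n) (y : Fin n → ℝ) (i : Fin (k + 1)) :
    (jetExt x y).2 i.castSucc = x.2 i := by simp [jetExt]

theorem jetExt_last (x : Jet k n) (y : Fin n → ℝ) : (jetExt x y).2 (Fin.last (k + 1)) = y := by
  simp [jetExt]

theorem jetProj_jetExt (x : Jet k n) (y : Fin n → ℝ) : jetProj (jetExt x y) = x :=
  Prod.ext rfl (funext fun i => jetExt_castSucc x y i)

theorem jetExt_jetProj (p : Jet (k + 1) n) : jetExt (jetProj p) (p.2 (Fin.last _)) = p := by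
  refine Prod.ext rfl (funext fun i => ?_)
  refine Fin.lastCases ?_ (fun i => ?_) i
  · exact jetExt_last _ _
  · exact jetExt_castSucc _ _ _

theorem contDiff_jetExt (y : Fin n → ℝ) : ContDiff ℝ ∞ (fun x : Jet k n => jetExt x y) := by
  refine contDiff_fst.prodMk (contDiff_pi.2 fun i => ?_)
  refine Fin.lastCases ?_ (fun i => ?_) i
  · simpa using contDiff_const
  · simp only [Fin.snoc_castSucc]
    fun_prop

theorem jetExt_eq_add (x : Jet k n) (y : Fin n → ℝ) :
    jetExt x y = jetExt x 0 + (0, Pi.single (Fin.last (k + 1)) y) := by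
  refine Prod.ext (by simp [jetExt]) (funext fun i => ?_)
  refine Fin.lastCases ?_ (fun i => ?_) i
  · simp [jetExt]
  · simp [jetExt, (Fin.castSucc_lt_last i).ne]

theorem hasFDerivAt_jetExt (x : Jet k n) (y : Fin n → ℝ) :
    HasFDerivAt (fun y => jetExt x y)
      ((ContinuousLinearMap.inr ℝ ℝ (Fin (k + 2) → Fin n → ℝ)).comp
        (ContinuousLinearMap.single ℝ (fun _ : Fin (k + 2) => Fin n → ℝ) (Fin.last (k + 1)))) y := by
  rw [show (fun y : Fin n → ℝ => jetExt x y) = fun y => jetExt x 0 +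
    (0, Pi.single (Fin.last (k + 1)) y) from funext (jetExt_eq_add x)]
  exact (ContinuousLinearMap.hasFDerivAt ((ContinuousLinearMap.inr ℝ ℝ (Fin (k + 2) → Fin n → ℝ)).comp
        (ContinuousLinearMap.single ℝ (fun _ : Fin (k + 2) => Fin n → ℝ)
          (Fin.last (k + 1))))).const_add (jetExt x 0)

end

/-! ### Dependence on the accelerations. -/

section

variable {n : ℕ} {I : Set ℝ} {Q V A : Set (Fin n → ℝ)}

theorem jetProj_mem_dom1 {p : Jet 2 n} (hp : p ∈ dom2 I Q V A) : jetProj p ∈ dom1 I Q V :=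
  ⟨hp.1, hp.2.1, hp.2.2.1⟩

theorem jetExt_mem_dom2 {x : Jet 1 n} (hx : x ∈ dom1 I Q V) {y : Fin n → ℝ} (hy : y ∈ A) :
    jetExt x y ∈ dom2 I Q V A :=
  ⟨hx.1, hx.2.1, hx.2.2, hy⟩

theorem jetExt_mem_dom3 {p : Jet 2 n} (hp : p ∈ dom2 I Q V A) (z : Fin n → ℝ) :
    jetExt p z ∈ dom3 I Q V A := by
  change jetProj (jetExt p z) ∈ dom2 I Q V A
  rwa [jetProj_jetExt]

theorem isOpen_dom3 (hI : IsOpen I) (hQ : IsOpen Q) (hV : IsOpen V) (hA : IsOpen A) :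
    IsOpen (dom3 I Q V A) :=
  (isOpen_dom2 hI hQ hV hA).preimage contDiff_jetProj.continuous

theorem eq_of_pd_two_eq_zero (hI : IsOpen I) (hQ : IsOpen Q) (hV : IsOpen V) (hA : IsOpen A)
    (hAc : IsPreconnected A) {F : Jet 2 n → ℝ} (hF : ContDiffOn ℝ ∞ F (dom2 I Q V A))
    (h : ∀ p ∈ dom2 I Q V A, ∀ c, pd 2 c F p = 0) {x : Jet 1 n} (hx : x ∈ dom1 I Q V)
    {y y' : Fin n → ℝ} (hy : y ∈ A) (hy' : y' ∈ A) : F (jetExt x y) = F (jetExt x y') := by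
  have hd : ∀ y ∈ A, HasFDerivAt (fun y => F (jetExt x y)) ((fderiv ℝ F (jetExt x y)).comp
      ((ContinuousLinearMap.inr ℝ ℝ (Fin 3 → Fin n → ℝ)).comp
        (ContinuousLinearMap.single ℝ (fun _ : Fin 3 => Fin n → ℝ) (Fin.last 2)))) y :=
    fun y hy => (((hF.contDiffAt ((isOpen_dom2 hI hQ hV hA).mem_nhds
      (jetExt_mem_dom2 hx hy))).differentiableAt (by simp)).hasFDerivAt).comp y
      (hasFDerivAt_jetExt x y)
  refine hA.is_const_of_fderiv_eq_zero (𝕜 := ℝ) (f := fun y => F (jetExt x y)) hAc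
    (fun y hy => (hd y hy).differentiableAt.differentiableWithinAt) (fun y hy => ?_) hy hy'
  rw [(hd y hy).fderiv]
  refine ContinuousLinearMap.coe_injective (LinearMap.pi_ext' fun c => LinearMap.ext_ring ?_)
  exact h _ (jetExt_mem_dom2 hx hy) c

/-- Near a point of `A` one can move a little along the `c`-th axis; the linear form then changes by
`ε * r c` with `ε ≠ 0`. -/
theorem eq_zero_of_sum_mul_const (hA : IsOpen A) (hne : A.Nonempty) {r : Fin n → ℝ}
    (h : ∀ y ∈ A, ∀ y' ∈ A, ∑ c, y c * r c = ∑ c, y' c * r c) (c : Fin n) : r c = 0 := by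
  obtain ⟨y, hy⟩ := hne
  have hcont : Filter.Tendsto (fun ε : ℝ => y + ε • Pi.single c (1 : ℝ)) (nhdsWithin 0 {0}ᶜ)
      (nhds y) := by
    have : Continuous fun ε : ℝ => y + ε • (Pi.single c (1 : ℝ) : Fin n → ℝ) := by fun_prop
    simpa using (this.tendsto 0).mono_left nhdsWithin_le_nhds
  obtain ⟨ε, hε, hε0⟩ := ((hcont.eventually (hA.mem_nhds hy)).and self_mem_nhdsWithin).exists
  have h1 := h _ hε _ hy
  simp only [Pi.add_apply, Pi.smul_apply, smul_eq_mul, add_mul, Finset.sum_add_distrib,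
    Pi.single_apply, mul_ite, mul_one, mul_zero, ite_mul, zero_mul, Finset.sum_ite_eq',
    Finset.mem_univ, if_true, add_eq_left] at h1
  exact (mul_eq_zero.1 h1).resolve_left hε0

end

/-! ### Equations affine in the accelerations. -/

section

open Smooth

variable {n : ℕ} {I : Set ℝ} {Q V A : Set (Fin n → ℝ)}

/-- The functions `f` are of the form `f_a = g_ab q̈^b + h_a`. -/
def IsAffineOn (A : Set (Fin n → ℝ)) (f : Fin n → Jet 2 n → ℝ)
    (g : Fin n → Fin n → Smooth (dom1 I Q V)) (h : Fin n → Smooth (dom1 I Q V)) : Prop :=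
  ∀ a, ∀ p ∈ dom2 I Q V A,
    f a p = ∑ b, rep (g a b) (jetProj p) * p.2 2 b + rep (h a) (jetProj p)

theorem totalDeriv_rep (hU : IsOpen (dom1 I Q V)) (F : Smooth (dom1 I Q V)) {p : Jet 2 n}
    (hp : jetProj p ∈ dom1 I Q V) :
    totalDeriv (rep F) p = rep ((jetDerivations hU).Dt F) (jetProj p)
      + ∑ c, p.2 2 c * rep ((jetDerivations hU).e c F) (jetProj p) := by
  rw [JetDerivations.Dt_apply, rep_add _ _ hp, rep_sum _ _ hp]
  simp only [rep_mul _ _ hp, jetDerivations, rep_dir hU _ _ hp, rep_jetCoord _ _ hp]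
  rw [totalDeriv, Fin.sum_univ_two, ← add_assoc]
  rfl

/-- Used to differentiate `rCoeff` and `sCoeff`, which are formally of third order, inside the
algebra of first-order functions. -/
theorem pd_eq_of_eq_rep {F : Jet 3 n → ℝ} (hU : IsOpen (dom1 I Q V))
    (hS : IsOpen (dom3 I Q V A)) {R : Smooth (dom1 I Q V)}
    (h : ∀ p ∈ dom3 I Q V A, F p = rep R (jetProj (jetProj p))) {p : Jet 3 n}
    (hp : p ∈ dom3 I Q V A) (i : Fin 2) (a : Fin n) :
    pd i.castSucc.castSucc a F p
      = rep (dir hU (jetUnit i a) R) (jetProj (jetProj p)) := by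
  have hx := jetProj_mem_dom1 hp
  have hd := differentiableAt_rep hU R hx
  have hd' : DifferentiableAt ℝ (fun p : Jet 2 n => rep R (jetProj p)) (jetProj p) :=
    hd.comp _ (hasFDerivAt_jetProj _).differentiableAt
  rw [pd, fderiv_congr_of_isOpen hS h hp, fderiv_comp_jetProj (p := p) hd',
    fderiv_comp_jetProj hd, rep_dir hU _ _ hx]
  change fderiv ℝ (rep R) _ (jetProj (jetProj (jetUnit i.castSucc.castSucc a))) = _
  rw [jetProj_jetUnit, jetProj_jetUnit]

variable {f : Fin n → Jet 2 n → ℝ} {g : Fin n → Fin n → Smooth (dom1 I Q V)}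
  {h : Fin n → Smooth (dom1 I Q V)}

theorem fderiv_affine (hU : IsOpen (dom1 I Q V)) (g : Fin n → Smooth (dom1 I Q V))
    (h : Smooth (dom1 I Q V)) {p : Jet 2 n} (hp : jetProj p ∈ dom1 I Q V) (u : Jet 2 n) :
    fderiv ℝ (fun p : Jet 2 n => ∑ b, rep (g b) (jetProj p) * p.2 2 b + rep h (jetProj p)) p u =
      ∑ b, (rep (dir hU (jetProj u) (g b)) (jetProj p) * p.2 2 b
        + rep (g b) (jetProj p) * u.2 2 b) + rep (dir hU (jetProj u) h) (jetProj p) := by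
  have hd : ∀ F : Smooth (dom1 I Q V), DifferentiableAt ℝ (fun p : Jet 2 n => rep F (jetProj p)) p :=
    fun F => (differentiableAt_rep hU F hp).comp _ (hasFDerivAt_jetProj _).differentiableAt
  have hd' : ∀ b, DifferentiableAt ℝ (fun p : Jet 2 n => p.2 2 b) p := fun b =>
    (contDiff_jetCoord 2 b).differentiable (by simp) p
  have hm : ∀ b, DifferentiableAt ℝ (fun p : Jet 2 n => rep (g b) (jetProj p) * p.2 2 b) p :=
    fun b => (hd _).mul (hd' b)
  rw [fderiv_fun_add (DifferentiableAt.fun_sum fun b _ => hm b) (hd h),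
    fderiv_fun_sum fun b _ => hm b]
  simp only [add_apply, sum_apply,
    fderiv_comp_jetProj (differentiableAt_rep hU _ hp), rep_dir hU _ _ hp]
  congr 1
  refine Finset.sum_congr rfl fun b _ => ?_
  rw [fderiv_fun_mul (hd _) (hd' b)]
  simp only [add_apply, smul_apply, smul_eq_mul,
    fderiv_comp_jetProj (differentiableAt_rep hU _ hp), fderiv_jetCoord]
  ring

end

section

open Smooth

variable {n : ℕ} {I : Set ℝ} {Q V A : Set (Fin n → ℝ)}
variable {f : Fin n → Jet 2 n → ℝ} {g : Fin n → Fin n → Smooth (dom1 I Q V)}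
  {h : Fin n → Smooth (dom1 I Q V)}

theorem pd_castSucc_affine (hU : IsOpen (dom1 I Q V)) (hS : IsOpen (dom2 I Q V A))
    (hf : IsAffineOn A f g h) (i : Fin 2) (a c : Fin n) {p : Jet 2 n} (hp : p ∈ dom2 I Q V A) :
    pd i.castSucc c (f a) p = ∑ b, rep (dir hU (jetUnit i c) (g a b)) (jetProj p) * p.2 2 b
      + rep (dir hU (jetUnit i c) (h a)) (jetProj p) := by
  rw [pd, fderiv_congr_of_isOpen hS (hf a) hp]
  have h1 := fderiv_affine hU (g a) (h a) (jetProj_mem_dom1 hp) (jetUnit i.castSucc c)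
  have h2 : (jetUnit i.castSucc c : Jet 2 n).2 2 = 0 := by
    fin_cases i <;> simp [jetUnit]
  simp only [jetProj_jetUnit, h2, Pi.zero_apply, mul_zero, add_zero] at h1
  exact h1

theorem pd_two_affine (hU : IsOpen (dom1 I Q V)) (hS : IsOpen (dom2 I Q V A))
    (hf : IsAffineOn A f g h) (a c : Fin n) {p : Jet 2 n} (hp : p ∈ dom2 I Q V A) :
    pd 2 c (f a) p = rep (g a c) (jetProj p) := by
  rw [pd, fderiv_congr_of_isOpen hS (hf a) hp]
  have h1 := fderiv_affine hU (g a) (h a) (jetProj_mem_dom1 hp) (jetUnit (Fin.last 2) c)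
  have h0 : ∀ F : Smooth (dom1 I Q V), rep (dir hU 0 F) (jetProj p) = 0 := fun F => by
    rw [rep_dir hU _ _ (jetProj_mem_dom1 hp), map_zero]
  have h2 : ∀ b, (jetUnit (Fin.last 2) c : Jet 2 n).2 2 b = if b = c then 1 else 0 := by
    intro b
    change (Pi.single (2 : Fin 3) (Pi.single c (1 : ℝ)) : Fin 3 → Fin n → ℝ) 2 b = _
    simp [Pi.single_apply]
  simp only [jetProj_jetUnit_last, h0, h2, zero_mul, zero_add, add_zero, mul_ite, mul_one,
    mul_zero, Finset.sum_ite_eq', Finset.mem_univ, if_true] at h1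
  exact h1

theorem sCoeff_affine (hU : IsOpen (dom1 I Q V)) (hS : IsOpen (dom2 I Q V A))
    (hf : IsAffineOn A f g h) (a b : Fin n) {p : Jet 3 n} (hp : p ∈ dom3 I Q V A) :
    sCoeff f a b p = rep ((jetDerivations hU).s g h a b) (jetProj (jetProj p))
      + ∑ c, p.2 2 c * rep ((jetDerivations hU).s₁ g a b c) (jetProj (jetProj p)) := by
  have hx := jetProj_mem_dom1 hp
  rw [sCoeff, totalDeriv_congr hS (fun x hx => pd_two_affine hU hS hf b a hx) hp,
    totalDeriv_comp_jetProj (differentiableAt_rep hU _ hx), totalDeriv_rep hU _ hx]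
  have h1 := fun a c => pd_castSucc_affine hU hS hf 1 a c hp
  have h2 : ∀ a c, pd 1 c (f a) (jetProj p) = _ := h1
  have h3 : (jetProj p).2 2 = p.2 2 := rfl
  simp only [h2, h3, JetDerivations.s, JetDerivations.s₁, rep_sub _ _ hx, rep_add _ _ hx,
    rep_smul _ _ hx, mul_sub, mul_add, Finset.sum_sub_distrib, Finset.sum_add_distrib]
  simp only [jetDerivations, Finset.mul_sum]
  have h4 : ∀ F : Fin n → ℝ, ∑ c, p.2 2 c * (1 / 2 * F c) = ∑ c, 1 / 2 * (F c * p.2 2 c) :=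
    fun F => Finset.sum_congr rfl fun c _ => by ring
  simp only [h4]
  ring

/-- By `hg` and `he` the accelerations cancel in `∂f_b/∂q̇^a - ∂f_a/∂q̇^b`, so its total derivative
contains no third derivatives. -/
theorem rCoeff_affine (hU : IsOpen (dom1 I Q V)) (hS : IsOpen (dom2 I Q V A))
    (hf : IsAffineOn A f g h) (hg : ∀ a b, g a b = g b a)
    (he : ∀ a b c, (jetDerivations hU).e c (g a b) = (jetDerivations hU).e b (g a c))
    (a b : Fin n) {p : Jet 3 n} (hp : p ∈ dom3 I Q V A) :
    rCoeff f a b p = rep ((jetDerivations hU).r h a b) (jetProj (jetProj p))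
      + ∑ c, p.2 2 c * rep ((jetDerivations hU).r₁ g h a b c) (jetProj (jetProj p)) := by
  have hx := jetProj_mem_dom1 hp
  have h1 : ∀ x ∈ dom2 I Q V A, pd 1 a (f b) x - pd 1 b (f a) x =
      rep ((jetDerivations hU).e a (h b) - (jetDerivations hU).e b (h a)) (jetProj x) := by
    intro x hx
    have h1 : ∀ a c, pd 1 c (f a) x = _ := fun a c => pd_castSucc_affine hU hS hf 1 a c hx
    have h2 : ∀ c, dir hU (jetUnit 1 a) (g b c) = dir hU (jetUnit 1 b) (g a c) := fun c => by
      have h3 := he c b a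
      rw [hg c b, hg c a] at h3
      exact h3
    simp only [h1, rep_sub _ _ (jetProj_mem_dom1 hx), jetDerivations, h2]
    ring
  rw [rCoeff, totalDeriv_congr hS h1 hp,
    totalDeriv_comp_jetProj (differentiableAt_rep hU _ hx), totalDeriv_rep hU _ hx]
  have h2 : ∀ a c, pd 0 c (f a) (jetProj p) = _ := fun a c => pd_castSucc_affine hU hS hf 0 a c hp
  have h3 : (jetProj p).2 2 = p.2 2 := rfl
  simp only [h2, h3, JetDerivations.r, JetDerivations.r₁, rep_sub _ _ hx, rep_add _ _ hx,
    rep_smul _ _ hx, mul_sub, mul_add, Finset.sum_sub_distrib, Finset.sum_add_distrib, map_sub]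
  simp only [jetDerivations, Finset.mul_sum]
  have h4 : ∀ F : Fin n → ℝ, ∑ c, p.2 2 c * (1 / 2 * F c) = ∑ c, 1 / 2 * (p.2 2 c * F c) :=
    fun F => Finset.sum_congr rfl fun c _ => by ring
  have h5 : ∀ F : Fin n → ℝ, ∑ c, F c * p.2 2 c = ∑ c, p.2 2 c * F c :=
    fun F => Finset.sum_congr rfl fun c _ => mul_comm _ _
  simp only [h4, h5]
  ring

theorem rCoeff_eq_rep (hU : IsOpen (dom1 I Q V)) (hS : IsOpen (dom2 I Q V A))
    (hf : IsAffineOn A f g h) (hg : ∀ a b, g a b = g b a)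
    (he : ∀ a b c, (jetDerivations hU).e c (g a b) = (jetDerivations hU).e b (g a c))
    (heh : ∀ a b c, (jetDerivations hU).e b ((jetDerivations hU).e c (h a))
        - (jetDerivations hU).e a ((jetDerivations hU).e c (h b)) =
      2 * ((jetDerivations hU).d b (g a c) - (jetDerivations hU).d a (g b c)))
    (a b : Fin n) {p : Jet 3 n} (hp : p ∈ dom3 I Q V A) :
    rCoeff f a b p = rep ((jetDerivations hU).r h a b) (jetProj (jetProj p)) := by
  rw [rCoeff_affine hU hS hf hg he a b hp]
  simp [fun c => (JetDerivations.r₁_eq_zero_iff a b c).2 (heh a b c),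
    rep_zero (jetProj_mem_dom1 hp)]

theorem sCoeff_eq_rep (hU : IsOpen (dom1 I Q V)) (hS : IsOpen (dom2 I Q V A))
    (hf : IsAffineOn A f g h) (hg : ∀ a b, g a b = g b a)
    (he : ∀ a b c, (jetDerivations hU).e c (g a b) = (jetDerivations hU).e b (g a c))
    (a b : Fin n) {p : Jet 3 n} (hp : p ∈ dom3 I Q V A) :
    sCoeff f a b p = rep ((jetDerivations hU).s g h a b) (jetProj (jetProj p)) := by
  rw [sCoeff_affine hU hS hf a b hp]
  simp [JetDerivations.s₁_eq_zero hg he, rep_zero (jetProj_mem_dom1 hp)]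

theorem isFirstOrderOn_iff (hA : IsOpen A) (hne : A.Nonempty) {F : Jet 3 n → ℝ}
    {R : Smooth (dom1 I Q V)} {R₁ : Fin n → Smooth (dom1 I Q V)}
    (hF : ∀ p ∈ dom3 I Q V A, F p = rep R (jetProj (jetProj p))
      + ∑ c, p.2 2 c * rep (R₁ c) (jetProj (jetProj p))) :
    IsFirstOrderOn (dom3 I Q V A) F ↔ ∀ c, R₁ c = 0 := by
  constructor
  · refine fun H c => ext_rep fun x hx => ?_
    rw [rep_zero hx]
    refine eq_zero_of_sum_mul_const hA hne (r := fun c => rep (R₁ c) x) (fun y hy y' hy' => ?_) c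
    -- The third derivatives do not occur in the formula for `F`, so they may be set to `0`.
    have hm : ∀ {y}, y ∈ A → jetExt (jetExt x y) 0 ∈ dom3 I Q V A := fun hy =>
      jetExt_mem_dom3 (jetExt_mem_dom2 hx hy) 0
    have hy2 : ∀ y, (jetExt (jetExt x y) 0 : Jet 3 n).2 2 = y := fun y =>
      (jetExt_castSucc (jetExt x y) 0 2).trans (jetExt_last x y)
    have h1 := H _ (hm hy) _ (hm hy') (by simp only [jetProj_jetExt])
    rw [hF _ (hm hy), hF _ (hm hy')] at h1
    simpa only [jetProj_jetExt, hy2, add_right_inj] using h1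
  · intro H p hp p' hp' hpp
    rw [hF p hp, hF p' hp', hpp]
    simp only [H, rep_zero (jetProj_mem_dom1 hp'), mul_zero]

theorem forall_dom2_iff (hne : A.Nonempty) {P : Jet 1 n → Prop} :
    (∀ p ∈ dom2 I Q V A, P (jetProj p)) ↔ ∀ x ∈ dom1 I Q V, P x := by
  obtain ⟨y, hy⟩ := hne
  refine ⟨fun H x hx => ?_, fun H p hp => H _ (jetProj_mem_dom1 hp)⟩
  simpa only [jetProj_jetExt] using H _ (jetExt_mem_dom2 hx hy)

theorem forall_dom3_iff (hne : A.Nonempty) {P : Jet 1 n → Prop} :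
    (∀ p ∈ dom3 I Q V A, P (jetProj (jetProj p))) ↔ ∀ x ∈ dom1 I Q V, P x := by
  rw [← forall_dom2_iff hne]
  refine ⟨fun H p hp => ?_, fun H p hp => H _ hp⟩
  simpa only [jetProj_jetExt] using H _ (jetExt_mem_dom3 hp 0)

theorem eq_iff_rep_eq {F F' : Smooth (dom1 I Q V)} :
    (∀ x ∈ dom1 I Q V, rep F x = rep F' x) ↔ F = F' :=
  ⟨ext_rep, fun h _ _ => by rw [h]⟩

/-- The conditions have to be decoded in a fixed order: symmetry of `g`, then `s`, whose
acceleration coefficients give `e_g`; only then is the affine formula for `r` available, and only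
once `r` and `s` are of first order does (iii) become the cyclic condition. -/
theorem reducedHelmholtz_iff_of_isAffineOn (hI : IsOpen I) (hQ : IsOpen Q) (hV : IsOpen V)
    (hA : IsOpen A) (hne : A.Nonempty) (hf : IsAffineOn A f g h) :
    ReducedHelmholtz I Q V A f ↔ (jetDerivations (isOpen_dom1 hI hQ hV)).Helmholtz g h := by
  have hU := isOpen_dom1 hI hQ hV
  have hS := isOpen_dom2 hI hQ hV hA
  have hS3 := isOpen_dom3 hI hQ hV hA
  have hs := fun a b => isFirstOrderOn_iff hA hne (fun p hp => sCoeff_affine hU hS hf a b hp)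
  have hsym : (∀ a b, ∀ p ∈ dom2 I Q V A, pd 2 b (f a) p = pd 2 a (f b) p) ↔
      ∀ a b, g a b = g b a := by
    refine forall_congr' fun a => forall_congr' fun b => ?_
    rw [← eq_iff_rep_eq, ← forall_dom2_iff hne]
    refine forall_congr' fun p => forall_congr' fun hp => ?_
    rw [pd_two_affine hU hS hf a b hp, pd_two_affine hU hS hf b a hp]
  have key : (∀ a b, g a b = g b a) →
      (∀ a b c, (jetDerivations hU).e c (g a b) = (jetDerivations hU).e b (g a c)) →
      ((∀ a b, IsFirstOrderOn (dom3 I Q V A) (rCoeff f a b)) ↔ ∀ a b c,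
      (jetDerivations hU).e b ((jetDerivations hU).e c (h a))
        - (jetDerivations hU).e a ((jetDerivations hU).e c (h b)) =
      2 * ((jetDerivations hU).d b (g a c) - (jetDerivations hU).d a (g b c))) := by
    intro hg he
    refine forall_congr' fun a => forall_congr' fun b => ?_
    rw [isFirstOrderOn_iff hA hne (fun p hp => rCoeff_affine hU hS hf hg he a b hp)]
    exact forall_congr' fun c => JetDerivations.r₁_eq_zero_iff a b c
  have key2 : (∀ a b, g a b = g b a) →
      (∀ a b c, (jetDerivations hU).e c (g a b) = (jetDerivations hU).e b (g a c)) →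
      (∀ a b c, (jetDerivations hU).e b ((jetDerivations hU).e c (h a))
        - (jetDerivations hU).e a ((jetDerivations hU).e c (h b)) =
      2 * ((jetDerivations hU).d b (g a c) - (jetDerivations hU).d a (g b c))) →
      ((∀ a b c, ∀ p ∈ dom3 I Q V A,
        pd 1 c (rCoeff f a b) p = pd 0 b (sCoeff f a c) p - pd 0 a (sCoeff f b c) p) ↔
      ∀ a b c, ((jetDerivations hU).d b ((jetDerivations hU).e c (h a))
        - (jetDerivations hU).d c ((jetDerivations hU).e b (h a)))
        + ((jetDerivations hU).d c ((jetDerivations hU).e a (h b))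
        - (jetDerivations hU).d a ((jetDerivations hU).e c (h b)))
        + ((jetDerivations hU).d a ((jetDerivations hU).e b (h c))
        - (jetDerivations hU).d b ((jetDerivations hU).e a (h c))) = 0) := by
    intro hg he heh
    refine forall_congr' fun a => forall_congr' fun b => forall_congr' fun c => ?_
    have hr := fun a b p hp => rCoeff_eq_rep (p := p) hU hS hf hg he heh a b hp
    have hs := fun a b p hp => sCoeff_eq_rep (p := p) hU hS hf hg he a b hp
    rw [← JetDerivations.e_r_eq_iff heh hg a b c, ← eq_iff_rep_eq, ← forall_dom3_iff hne]
    refine forall_congr' fun p => forall_congr' fun hp => ?_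
    rw [rep_sub _ _ (jetProj_mem_dom1 hp)]
    exact Eq.congr (pd_eq_of_eq_rep hU hS3 (hr a b) hp 1 c)
      (congrArg₂ (· - ·) (pd_eq_of_eq_rep hU hS3 (hs a c) hp 0 b)
        (pd_eq_of_eq_rep hU hS3 (hs b c) hp 0 a))
  constructor
  · rintro ⟨h1, h2, h3, h4⟩
    have hg := hsym.1 h3
    have he := JetDerivations.e_g_of_s₁_eq_zero hg fun a b => (hs a b).1 (h2 a b)
    have heh := (key hg he).1 h1
    exact ⟨hg, he, heh, (key2 hg he heh).1 h4⟩
  · rintro ⟨hg, he, heh, hc⟩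
    exact ⟨(key hg he).2 heh, fun a b => (hs a b).2 (JetDerivations.s₁_eq_zero hg he a b),
      hsym.2 hg, (key2 hg he heh).2 hc⟩

end

/-! ### Reduction to the affine case and translation to the algebra. -/

section

open Smooth

variable {n : ℕ} {I : Set ℝ} {Q V A : Set (Fin n → ℝ)} {f : Fin n → Jet 2 n → ℝ}

/-- This derivative is, up to sign, the coefficient of the `c`-th third derivative in `sCoeff f b
a`. Since third derivatives are unrestricted, the values `Pi.single c 1` and `0` can be compared. -/
theorem pd_pd_eq_zero_of_isFirstOrderOn {a b : Fin n}
    (hs : IsFirstOrderOn (dom3 I Q V A) (sCoeff f b a)) {p : Jet 2 n} (hp : p ∈ dom2 I Q V A)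
    (c : Fin n) : pd 2 c (pd 2 b (f a)) p = 0 := by
  have h1 := hs _ (jetExt_mem_dom3 hp (Pi.single c 1)) _ (jetExt_mem_dom3 hp 0)
    (by simp only [jetProj_jetExt])
  have h2 : ∀ z, (jetExt p z).2 (Fin.succ 0) = p.2 1 := fun z => jetExt_castSucc p z 1
  have h3 : ∀ z, (jetExt p z).2 (Fin.succ 1) = p.2 2 := fun z => jetExt_castSucc p z 2
  have h4 : ∀ z, (jetExt p z).2 (Fin.succ 2) = z := fun z => jetExt_last p z
  have h5 : ∀ z, ∑ i : Fin (2 + 1), ∑ d, (jetExt p z).2 i.succ d * pd i d (pd 2 b (f a)) p =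
      ∑ d, p.2 1 d * pd 0 d (pd 2 b (f a)) p + ∑ d, p.2 2 d * pd 1 d (pd 2 b (f a)) p
        + ∑ d, z d * pd 2 d (pd 2 b (f a)) p := fun z => by
    rw [Fin.sum_univ_three, h2, h3, h4]
  simp only [sCoeff, totalDeriv, jetProj_jetExt, h5] at h1
  simpa [Pi.single_apply] using h1

theorem exists_isAffineOn (hI : IsOpen I) (hQ : IsOpen Q) (hV : IsOpen V) (hA : IsOpen A)
    (hAc : IsPreconnected A) (hne : A.Nonempty)
    (hf : ∀ a, ContDiffOn ℝ ∞ (f a) (dom2 I Q V A))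
    (hs : ∀ a b, IsFirstOrderOn (dom3 I Q V A) (sCoeff f a b)) :
    ∃ (g : Fin n → Fin n → Smooth (dom1 I Q V)) (h : Fin n → Smooth (dom1 I Q V)),
      IsAffineOn A f g h := by
  have hU := isOpen_dom1 hI hQ hV
  have hS := isOpen_dom2 hI hQ hV hA
  obtain ⟨y₀, hy₀⟩ := hne
  have hpd : ∀ a b, ContDiffOn ℝ ∞ (pd 2 b (f a)) (dom2 I Q V A) := fun a b =>
    contDiffOn_fderiv_apply hS (hf a) _
  have hres : ∀ F : Jet 2 n → ℝ, ContDiffOn ℝ ∞ F (dom2 I Q V A) →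
      ContDiffOn ℝ ∞ (fun x => F (jetExt x y₀)) (dom1 I Q V) := fun F hF =>
    hF.comp (contDiff_jetExt y₀).contDiffOn fun x hx => jetExt_mem_dom2 hx hy₀
  -- The derivatives `∂f_a/∂q̈^b` do not depend on the acceleration, so they may be evaluated at the
  -- fixed `y₀ ∈ A`; this also shows that they are smooth on `dom1`.
  let g : Fin n → Fin n → Smooth (dom1 I Q V) := fun a b => mk _ (hres _ (hpd a b))
  have hg : ∀ a b, ∀ p ∈ dom2 I Q V A, pd 2 b (f a) p = rep (g a b) (jetProj p) := by
    intro a b p hp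
    rw [rep_mk _ (jetProj_mem_dom1 hp)]
    conv_lhs => rw [← jetExt_jetProj p]
    exact eq_of_pd_two_eq_zero hI hQ hV hA hAc (hpd a b)
      (fun p hp c => pd_pd_eq_zero_of_isFirstOrderOn (hs b a) hp c) (jetProj_mem_dom1 hp)
      hp.2.2.2 hy₀
  -- The zero summand puts `L` in the shape of `IsAffineOn`, so that `pd_two_affine` applies. The
  -- difference `f a - L a` is then independent of the acceleration and provides `h a`.
  let L : Fin n → Jet 2 n → ℝ := fun a p =>
    ∑ b, rep (g a b) (jetProj p) * p.2 2 b + rep (0 : Smooth (dom1 I Q V)) (jetProj p)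
  have hrep : ∀ F : Smooth (dom1 I Q V), ContDiffOn ℝ ∞ (fun p : Jet 2 n => rep F (jetProj p))
      (dom2 I Q V A) := fun F =>
    (contDiffOn_rep F).comp contDiff_jetProj.contDiffOn fun p hp => jetProj_mem_dom1 hp
  have hL : ∀ a, ContDiffOn ℝ ∞ (L a) (dom2 I Q V A) := fun a =>
    (ContDiffOn.sum fun b _ => (hrep (g a b)).mul (contDiff_jetCoord 2 b).contDiffOn).add (hrep 0)
  have hd : ∀ a, ∀ p ∈ dom2 I Q V A, ∀ c, pd 2 c (fun p => f a p - L a p) p = 0 := by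
    intro a p hp c
    rw [pd, fderiv_fun_sub (((hf a).contDiffAt (hS.mem_nhds hp)).differentiableAt (by simp))
      (((hL a).contDiffAt (hS.mem_nhds hp)).differentiableAt (by simp))]
    have h1 : pd 2 c (L a) p = rep (g a c) (jetProj p) :=
      pd_two_affine hU hS (f := L) (g := g) (h := 0) (fun a p _ => rfl) a c hp
    exact sub_eq_zero.2 ((hg a c p hp).trans h1.symm)
  refine ⟨g, fun a => mk _ (hres _ ((hf a).sub (hL a))), fun a p hp => ?_⟩
  have hx := jetProj_mem_dom1 hp
  have h1 := eq_of_pd_two_eq_zero hI hQ hV hA hAc ((hf a).sub (hL a)) (hd a) hx hp.2.2.2 hy₀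
  have h2 : f a p - L a p = f a (jetExt (jetProj p) y₀) - L a (jetExt (jetProj p) y₀) := by
    rw [← h1]
    exact congrArg (fun p => f a p - L a p) (jetExt_jetProj p).symm
  rw [rep_mk _ hx]
  refine (sub_eq_iff_eq_add'.1 h2).trans ?_
  simp only [L, rep_zero hx, add_zero]

theorem isLagrangianDissipative_iff (hU : IsOpen (dom1 I Q V)) :
    IsLagrangianDissipative I Q V A f ↔ ∃ Λ D : Smooth (dom1 I Q V), IsAffineOn A f
      (fun a b => (jetDerivations hU).e b ((jetDerivations hU).e a Λ))
      (fun a => (jetDerivations hU).Dt ((jetDerivations hU).e a Λ) - (jetDerivations hU).d a Λ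
        + (jetDerivations hU).e a D) := by
  have key : ∀ (Λ D : Jet 1 n → ℝ) (Λ' D' : Smooth (dom1 I Q V)),
      (∀ x ∈ dom1 I Q V, rep Λ' x = Λ x) → (∀ x ∈ dom1 I Q V, rep D' x = D x) →
      ∀ a, ∀ p ∈ dom2 I Q V A,
        totalDeriv (pd 1 a Λ) p - pd 0 a Λ (jetProj p) + pd 1 a D (jetProj p) =
        ∑ b, rep ((jetDerivations hU).e b ((jetDerivations hU).e a Λ')) (jetProj p) * p.2 2 b
          + rep ((jetDerivations hU).Dt ((jetDerivations hU).e a Λ') - (jetDerivations hU).d a Λ'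
            + (jetDerivations hU).e a D') (jetProj p) := by
    intro Λ D Λ' D' hΛ hD a p hp
    have hx := jetProj_mem_dom1 hp
    have h1 : ∀ x ∈ dom1 I Q V, pd 1 a Λ x = rep ((jetDerivations hU).e a Λ') x :=
      fun x hx => (rep_dir_of_eq hU _ _ hΛ hx).symm
    have h2 : pd 0 a Λ (jetProj p) = rep ((jetDerivations hU).d a Λ') (jetProj p) :=
      (rep_dir_of_eq hU _ _ hΛ hx).symm
    have h3 : pd 1 a D (jetProj p) = rep ((jetDerivations hU).e a D') (jetProj p) :=
      (rep_dir_of_eq hU _ _ hD hx).symm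
    rw [totalDeriv_congr hU h1 hx, totalDeriv_rep hU _ hx, h2, h3, rep_add _ _ hx, rep_sub _ _ hx,
      Finset.sum_congr rfl fun b _ => mul_comm (p.2 2 b) _]
    ring
  constructor
  · rintro ⟨Λ, D, hΛ, hD, H⟩
    refine ⟨mk Λ hΛ, mk D hD, fun a p hp => (H a p hp).trans ?_⟩
    exact key Λ D _ _ (fun x hx => rep_mk _ hx) (fun x hx => rep_mk _ hx) a p hp
  · rintro ⟨Λ, D, H⟩
    refine ⟨rep Λ, rep D, contDiffOn_rep Λ, contDiffOn_rep D, fun a p hp => (H a p hp).trans ?_⟩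
    exact (key _ _ Λ D (fun _ _ => rfl) (fun _ _ => rfl) a p hp).symm

theorem pd_pd_eq_rep (hU : IsOpen (dom1 I Q V)) {F : Jet 1 n → ℝ} {F' : Smooth (dom1 I Q V)}
    (hF : ∀ x ∈ dom1 I Q V, rep F' x = F x) (i j : Fin 2) (a b : Fin n) {x : Jet 1 n}
    (hx : x ∈ dom1 I Q V) :
    pd i a (pd j b F) x = rep (dir hU (jetUnit i a) (dir hU (jetUnit j b) F')) x :=
  (rep_dir_of_eq hU _ _ (fun _ hy => rep_dir_of_eq hU _ _ hF hy) hx).symm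

theorem coefficientHelmholtz_iff (hU : IsOpen (dom1 I Q V)) :
    CoefficientHelmholtz I Q V A f ↔ ∃ (g : Fin n → Fin n → Smooth (dom1 I Q V))
      (h : Fin n → Smooth (dom1 I Q V)), IsAffineOn A f g h ∧
        (jetDerivations hU).Helmholtz g h := by
  have key : ∀ (g : Fin n → Fin n → Jet 1 n → ℝ) (h : Fin n → Jet 1 n → ℝ)
      (g' : Fin n → Fin n → Smooth (dom1 I Q V)) (h' : Fin n → Smooth (dom1 I Q V)),
      (∀ a b, ∀ x ∈ dom1 I Q V, rep (g' a b) x = g a b x) →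
      (∀ a, ∀ x ∈ dom1 I Q V, rep (h' a) x = h a x) →
      (((∀ a b, ∀ x ∈ dom1 I Q V, g a b x = g b a x) ∧
        (∀ a b c, ∀ x ∈ dom1 I Q V, pd 1 c (g a b) x - pd 1 b (g a c) x = 0) ∧
        (∀ a b c, ∀ x ∈ dom1 I Q V,
          pd 1 b (pd 1 c (h a)) x - pd 1 a (pd 1 c (h b)) x
            = 2 * (pd 0 b (g a c) x - pd 0 a (g b c) x)) ∧
        (∀ a b c, ∀ x ∈ dom1 I Q V,
          (pd 0 b (pd 1 c (h a)) x - pd 0 c (pd 1 b (h a)) x)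
            + (pd 0 c (pd 1 a (h b)) x - pd 0 a (pd 1 c (h b)) x)
            + (pd 0 a (pd 1 b (h c)) x - pd 0 b (pd 1 a (h c)) x) = 0)) ↔
      (jetDerivations hU).Helmholtz g' h') := by
    intro g h g' h' hg hh
    have h1 : ∀ i a b c, ∀ x ∈ dom1 I Q V, pd i c (g a b) x =
        rep (dir hU (jetUnit i c) (g' a b)) x := fun i a b c x hx =>
      (rep_dir_of_eq hU _ _ (hg a b) hx).symm
    have h2 := fun (i j : Fin 2) a b c x hx => pd_pd_eq_rep (x := x) hU (hh a) i j b c hx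
    have e1 : ∀ a b, (∀ x ∈ dom1 I Q V, g a b x = g b a x) ↔ g' a b = g' b a := by
      intro a b
      rw [← eq_iff_rep_eq]
      exact forall₂_congr fun x hx => by rw [hg _ _ x hx, hg _ _ x hx]
    have e2 : ∀ a b c, (∀ x ∈ dom1 I Q V, pd 1 c (g a b) x - pd 1 b (g a c) x = 0) ↔
        (jetDerivations hU).e c (g' a b) = (jetDerivations hU).e b (g' a c) := by
      intro a b c
      rw [← eq_iff_rep_eq]
      refine forall₂_congr fun x hx => ?_
      rw [h1 1 a b c x hx, h1 1 a c b x hx, sub_eq_zero]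
      rfl
    have e3 : ∀ a b c, (∀ x ∈ dom1 I Q V, pd 1 b (pd 1 c (h a)) x - pd 1 a (pd 1 c (h b)) x
        = 2 * (pd 0 b (g a c) x - pd 0 a (g b c) x)) ↔
        (jetDerivations hU).e b ((jetDerivations hU).e c (h' a))
          - (jetDerivations hU).e a ((jetDerivations hU).e c (h' b))
        = 2 * ((jetDerivations hU).d b (g' a c) - (jetDerivations hU).d a (g' b c)) := by
      intro a b c
      rw [← eq_iff_rep_eq, two_mul]
      refine forall₂_congr fun x hx => ?_
      rw [h2 1 1 a b c x hx, h2 1 1 b a c x hx, h1 0 a c b x hx, h1 0 b c a x hx]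
      simp only [rep_sub _ _ hx, rep_add _ _ hx, two_mul]
      rfl
    have e4 : ∀ a b c, (∀ x ∈ dom1 I Q V,
        (pd 0 b (pd 1 c (h a)) x - pd 0 c (pd 1 b (h a)) x)
          + (pd 0 c (pd 1 a (h b)) x - pd 0 a (pd 1 c (h b)) x)
          + (pd 0 a (pd 1 b (h c)) x - pd 0 b (pd 1 a (h c)) x) = 0) ↔
        ((jetDerivations hU).d b ((jetDerivations hU).e c (h' a))
          - (jetDerivations hU).d c ((jetDerivations hU).e b (h' a)))
        + ((jetDerivations hU).d c ((jetDerivations hU).e a (h' b))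
          - (jetDerivations hU).d a ((jetDerivations hU).e c (h' b)))
        + ((jetDerivations hU).d a ((jetDerivations hU).e b (h' c))
          - (jetDerivations hU).d b ((jetDerivations hU).e a (h' c))) = 0 := by
      intro a b c
      rw [← eq_iff_rep_eq]
      refine forall₂_congr fun x hx => ?_
      rw [h2 0 1 a b c x hx, h2 0 1 a c b x hx, h2 0 1 b c a x hx, h2 0 1 b a c x hx,
        h2 0 1 c a b x hx, h2 0 1 c b a x hx]
      simp only [rep_sub _ _ hx, rep_add _ _ hx, rep_zero hx]
      rfl
    simp only [e1, e2, e3, e4]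
    exact ⟨fun ⟨h1, h2, h3, h4⟩ => ⟨h1, h2, h3, h4⟩, fun ⟨h1, h2, h3, h4⟩ => ⟨h1, h2, h3, h4⟩⟩
  constructor
  · rintro ⟨g, h, hg, hh, hf, H⟩
    refine ⟨fun a b => mk _ (hg a b), fun a => mk _ (hh a), fun a p hp => ?_,
      (key g h _ _ (fun a b x hx => rep_mk _ hx) fun a x hx => rep_mk _ hx).1 H⟩
    rw [hf a p hp]
    simp only [rep_mk _ (jetProj_mem_dom1 hp)]
  · rintro ⟨g, h, hf, H⟩
    exact ⟨fun a b => rep (g a b), fun a => rep (h a), fun a b => contDiffOn_rep _,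
      fun a => contDiffOn_rep _, hf,
      (key _ _ g h (fun _ _ _ _ => rfl) fun _ _ _ => rfl).2 H⟩

theorem reducedHelmholtz_iff_exists (hI : IsOpen I) (hQ : IsOpen Q) (hV : IsOpen V)
    (hA : IsOpen A) (hAc : IsPreconnected A) (hne : A.Nonempty)
    (hf : ∀ a, ContDiffOn ℝ ∞ (f a) (dom2 I Q V A)) :
    ReducedHelmholtz I Q V A f ↔ ∃ (g : Fin n → Fin n → Smooth (dom1 I Q V))
      (h : Fin n → Smooth (dom1 I Q V)), IsAffineOn A f g h ∧
        (jetDerivations (isOpen_dom1 hI hQ hV)).Helmholtz g h := by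
  constructor
  · intro H
    obtain ⟨g, h, hgh⟩ := exists_isAffineOn hI hQ hV hA hAc hne hf H.2.1
    exact ⟨g, h, hgh, (reducedHelmholtz_iff_of_isAffineOn hI hQ hV hA hne hgh).1 H⟩
  · rintro ⟨g, h, hgh, H⟩
    exact (reducedHelmholtz_iff_of_isAffineOn hI hQ hV hA hne hgh).2 H

end

theorem mainTheorem1 {n : ℕ} (I : Set ℝ) (Q V A : Set (Fin n → ℝ)) (q₀ v₀ : Fin n → ℝ)
    (hI : IsOpen I) (hQ : IsOpen Q) (hV : IsOpen V) (hA : IsOpen A)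
    (hQs : StarConvex ℝ q₀ Q) (hVs : StarConvex ℝ v₀ V) (hAc : IsPreconnected A)
    (f : Fin n → Jet 2 n → ℝ) (hf : ∀ a, ContDiffOn ℝ ∞ (f a) (dom2 I Q V A)) :
    -- the necessary and sufficient conditions
    (IsLagrangianDissipative I Q V A f ↔ ReducedHelmholtz I Q V A f) ∧
    -- the two redundant conditions
    (ReducedHelmholtz I Q V A f →
      (∀ a b c, ∀ p ∈ dom3 I Q V A, pd 1 c (sCoeff f a b) p = pd 1 b (sCoeff f a c) p) ∧
      (∀ a b c, ∀ p ∈ dom3 I Q V A,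
        pd 0 c (rCoeff f a b) p + pd 0 a (rCoeff f b c) p + pd 0 b (rCoeff f c a) p = 0)) ∧
    -- the equivalent formulation in terms of the coefficients
    (ReducedHelmholtz I Q V A f ↔ CoefficientHelmholtz I Q V A f) := by
  have hU := isOpen_dom1 hI hQ hV
  have hS := isOpen_dom2 hI hQ hV hA
  have hS3 := isOpen_dom3 hI hQ hV hA
  -- For empty `A` everything on `dom2` and `dom3` is vacuous, but the conditions on the
  -- coefficients still live on `dom1`; zero coefficients satisfy them.
  rcases A.eq_empty_or_nonempty with rfl | hne
  · have h2 : ∀ p : Jet 2 n, p ∉ dom2 I Q V ∅ := fun p hp => hp.2.2.2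
    have h3 : ∀ p : Jet 3 n, p ∉ dom3 I Q V ∅ := fun p hp => h2 _ hp
    have hred : ReducedHelmholtz I Q V ∅ f :=
      ⟨fun _ _ p hp => (h3 p hp).elim, fun _ _ p hp => (h3 p hp).elim,
        fun _ _ p hp => (h2 p hp).elim, fun _ _ _ p hp => (h3 p hp).elim⟩
    refine ⟨⟨fun _ => hred, fun _ => ?_⟩, fun _ => ⟨fun _ _ _ p hp => (h3 p hp).elim,
      fun _ _ _ p hp => (h3 p hp).elim⟩, ⟨fun _ => ?_, fun _ => hred⟩⟩
    · exact ⟨0, 0, contDiffOn_const, contDiffOn_const, fun _ p hp => (h2 p hp).elim⟩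
    · exact (coefficientHelmholtz_iff hU).2 ⟨0, 0, fun _ p hp => (h2 p hp).elim, by
        constructor <;> simp⟩
  have hred := reducedHelmholtz_iff_exists hI hQ hV hA hAc hne hf
  refine ⟨?_, fun H => ?_, hred.trans (coefficientHelmholtz_iff hU).symm⟩
  · rw [hred, isLagrangianDissipative_iff hU]
    constructor
    · rintro ⟨Λ, D, H⟩
      exact ⟨_, _, H, JetDerivations.IsLagrangian.helmholtz (Λ := Λ) (D := D)
        ⟨fun _ _ => rfl, fun _ => rfl⟩⟩
    · rintro ⟨g, h, hgh, H⟩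
      obtain ⟨Λ, D, hg, hh⟩ := H.exists_isLagrangian
        (exists_potential hU fun x hx τ hτ => (segment_mem_dom1 hQs hVs hx hτ).2)
        (exists_potential_of_closed hU fun x hx τ hτ => (segment_mem_dom1 hQs hVs hx hτ).1)
      refine ⟨Λ, D, fun a p hp => ?_⟩
      simp only [hgh a p hp, hg, hh]
  · obtain ⟨g, h, hgh, H⟩ := hred.1 H
    have hr := fun a b p hp => rCoeff_eq_rep (p := p) hU hS hgh H.symm H.e_g H.e_e_h a b hp
    have hs := fun a b p hp => sCoeff_eq_rep (p := p) hU hS hgh H.symm H.e_g a b hp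
    refine ⟨fun a b c p hp => ?_, fun a b c p hp => ?_⟩
    · exact ((pd_eq_of_eq_rep hU hS3 (hs a b) hp 1 c).trans
        (congrArg (fun F => Smooth.rep F _) (H.e_s a b c))).trans
        (pd_eq_of_eq_rep hU hS3 (hs a c) hp 1 b).symm
    · have hx := jetProj_mem_dom1 hp
      have h1 : ∀ a b c, pd 0 c (rCoeff f a b) p = _ := fun a b c =>
        pd_eq_of_eq_rep hU hS3 (hr a b) hp 0 c
      rw [h1, h1, h1, ← Smooth.rep_add _ _ hx, ← Smooth.rep_add _ _ hx]
      exact (congrArg (fun F => Smooth.rep F _) (H.d_r a b c)).trans (Smooth.rep_zero hx)
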